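/- Let $A$ be a nonempty finite set. A *partition* of $A$ is a finite set $P$ of pairwise disjoint (possibly empty) subsets of $A$ with union $A$; $Q$ is *coarser* than $P$ if every member of $Q$ is a union of members of $P$. The blocks of the common coarsening $P\vee P'$ are the minimal sets that are unions of members of $P$ as well as of $P'$. A *scenario* on $A$ is a pair $(\mathcal P,\mathcal S)$ of a set $\mathcal P$ of partitions of $A$ and a set $\mathcal S$ of subsets of $A$ such that (i) $\mathcal P$ is closed under coarser partitions; (ii) if $X\subseteq S\in\mathcal S$ and $X\in P$ for some $P\in\mathcal P$, then $X\in\mathcal S$; (iii) $\{S,A\setminus S\}\in\mathcal P$ for all $S\in\mathcal S$. In the *captain and robber game* on $(\mathcal P,\mathcal S)$ the captain first chooses $\{A\}$ (she loses if $\{A\}\notin\mathcal P$) and the robber chooses an element of $A$. If the captain's partition is $P$ and the robber is on $r\in X\in P$ ($X$ is the *robber space*), the captain announces a partition $P'\in\mathcal P$, and the robber moves to any element $r'$ of the block of $P\vee P'$ that contains $X$; the new position is $(P',r')$. The captain wins if at some point the robber space is in $\mathcal S$. In the *monotone* game the captain may only choose $P'$ such that $X$ is a union of members of $P'$. The scenario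 is *monotone* if the captain has a winning strategy in the game if and only if she has one in the monotone game. A *tree decomposition* of $(\mathcal P,\mathcal S)$ is a finite tree $T$ with a map $\tau$ from its leaves (the nodes of degree at most $1$) to $\mathcal S$ such that the image of $\tau$ is a partition of $A$ and, for every internal node $t$, the set of the unions $\bigcup\tau(L(T)\cap V(T'))$, over the components $T'$ of $T-t$, belongs to $\mathcal P$ (here $L(T)$ is the set of leaves of $T$). For $f\colon 2^A\to\mathbb N$ the *branch-width* $\mathrm{bw}(f)$ is the minimum, over all trees $T$ whose internal nodes all have degree $3$ and all bijections from $A$ to the leaves of $T$, of the maximum of $f(X_e)$ over the edges $e$ of $T$, where $X_e$ is the set of elements on one side of $e$ (the maximum is $0$ if $T$ has no edge). Let $\mathcal P_f^k$ be the set of all partitions $P$ of $A$ with $\sum_{X\in P}f(X)\le k$, and $\mathcal S_{\mathrm{sing}}=\{\emptyset\}\cup\{\{a\}\mid a\in A\}$. For a nonempty finite simple graph $G$ and $X\subseteq V(G)$ let $\mathrm{cutrk}_G(X)$ be the $\mathrm{GF}(2)$-rank of the $X\times(V(G)\setminus X)$ submatrix of the adjacency matrix, and let $\delta_G(X)$ be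 the number of edges between $X$ and $V(G)\setminus X$. *Rank-width* of $G$ is $\mathrm{bw}(\mathrm{cutrk}_G)$, and *carving-width* of $G$ is $\mathrm{bw}(\delta_G)$. For a nonempty finite directed graph $D$ let $\mathrm{GF}(4)=\{0,1,a,a^2\}$ and let $M$ be the matrix with entry $M_{xy}=1$ if $xy$ and $yx$ are both arcs, $a$ if only $xy$ is an arc, $a^2$ if only $yx$ is an arc, and $0$ if neither is. *$\mathrm{GF}(4)$-rank-width* of $D$ is $\mathrm{bw}(f)$ for $f(X)=\mathrm{rk}\,M[X,V(D)\setminus X]$. *Bi-rank-width* of $D$ is $\mathrm{bw}(f)$ for $f(X)=\mathrm{rk}\,N[X,V(D)\setminus X]+\mathrm{rk}\,N[V(D)\setminus X,X]$, where $N$ is the adjacency matrix of $D$ over $\mathrm{GF}(2)$. **Corollary.** Let $f$ be any of these four functions (on $A=V(G)$ or $A=V(D)$), so that $\mathrm{bw}(f)$ is rank-width or carving-width of $G$, or $\mathrm{GF}(4)$-rank-width or bi-rank-width of $D$. Then 1. $(\mathcal P_f^k,\mathcal S_{\mathrm{sing}})$ is a scenario for every integer $k\ge 2\max_{a\in A}f(\{a\})$.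 2. Whenever $(\mathcal P_f^k,\mathcal S_{\mathrm{sing}})$ is a scenario, it is monotone, and the captain has a winning strategy in the monotone game on it if and only if it has a tree decomposition. 3. Let $g$ be the least $k$ such that $(\mathcal P_f^k,\mathcal S_{\mathrm{sing}})$ is a scenario on which the captain has a winning strategy in the monotone game. Then $g$ exists, $g$ is also the least $k$ such that $(\mathcal P_f^k,\mathcal S_{\mathrm{sing}})$ is a scenario with a tree decomposition, and $$\mathrm{bw}(f)\le g\le 3\cdot\mathrm{bw}(f).$$ -/

import Mathlib

namespace CaptainRobber

section Partitions

variable {A : Type*} [Fintype A] [DecidableEq A]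

/-- `P` is a partition of `A`: its members are pairwise disjoint with union `A`.
The empty set is allowed as a member. -/
def IsPartition (P : Finset (Finset A)) : Prop :=
  (∀ X ∈ P, ∀ Y ∈ P, X ≠ Y → Disjoint X Y) ∧ P.sup id = Finset.univ

/-- `X` is the union of one or more members of `P`. -/
def IsUnionOf (X : Finset A) (P : Finset (Finset A)) : Prop :=
  ∃ R, R ⊆ P ∧ R.Nonempty ∧ X = R.sup id

/-- `P` is coarser than `Q`. -/
def IsCoarser (P Q : Finset (Finset A)) : Prop :=
  ∀ X ∈ P, IsUnionOf X Q

/-- The blocks of the common coarsening `P ∨ Q`: the minimal sets that are both a union of members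
of `P` and a union of members of `Q` (and the empty set if it belongs to both). -/
def commonCoarsening (P Q : Finset (Finset A)) : Set (Finset A) :=
  {Y | IsUnionOf Y P ∧ IsUnionOf Y Q ∧
    ∀ Z, Z ⊆ Y → Z.Nonempty → IsUnionOf Z P → IsUnionOf Z Q → Z = Y}

/-- A scenario `(Ps, Ss)` on `A`. -/
structure IsScenario (Ps : Set (Finset (Finset A))) (Ss : Set (Finset A)) : Prop where
  isPartition : ∀ P ∈ Ps, IsPartition P
  coarser_mem : ∀ P ∈ Ps, ∀ Q, IsPartition Q → IsCoarser Q P → Q ∈ Ps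
  subset_mem : ∀ S ∈ Ss, ∀ X ⊆ S, (∃ P ∈ Ps, X ∈ P) → X ∈ Ss
  pair_mem : ∀ S ∈ Ss, {S, Sᶜ} ∈ Ps

end Partitions

section Game

variable {A : Type*} [Fintype A] [DecidableEq A]

/-- A position `(P, r)`: the captain's current partition and the robber's current element. -/
abbrev Position (A : Type*) := Finset (Finset A) × A

/-- A strategy of the captain: from the list of earlier positions and the current position it
computes the next partition. -/
abbrev Strategy (A : Type*) := List (Position A) → Position A → Finset (Finset A)

/-- The captain's possible moves in the captain and robber game. -/
def moves (Ps : Set (Finset (Finset A))) (_q : Position A) : Set (Finset (Finset A)) := Ps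

/-- The captain's possible moves in the monotone game: the new partition has to refine the robber
space, that is, the block of the current partition that contains the robber. -/
def monotoneMoves (Ps : Set (Finset (Finset A))) (q : Position A) : Set (Finset (Finset A)) :=
  {P' | P' ∈ Ps ∧ ∀ X ∈ q.1, q.2 ∈ X → IsUnionOf X P'}

/-- When the captain moves from the partition of `q` to the partition of `q'`, the robber may run
from `q.2` to `q'.2`, inside the block of the common coarsening that contains the robber space. -/
def CanRun (q q' : Position A) : Prop :=
  ∃ X ∈ q.1, q.2 ∈ X ∧ ∃ Y ∈ commonCoarsening q.1 q'.1, X ⊆ Y ∧ q'.2 ∈ Y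

/-- The robber space is simple. -/
def Caught (Ss : Set (Finset A)) (q : Position A) : Prop :=
  ∃ X ∈ q.1, q.2 ∈ X ∧ X ∈ Ss

/-- `p` is a play (continued forever) in which the captain follows the strategy `σ`. -/
def IsPlay (σ : Strategy A) (p : ℕ → Position A) : Prop :=
  (p 0).1 = {Finset.univ} ∧
    ∀ n, (p (n + 1)).1 = σ ((List.range n).map p) (p n) ∧ CanRun (p n) (p (n + 1))

/-- The captain has a winning strategy, where `M` gives her legal moves at each position. -/
def HasWinningStrategy (Ps : Set (Finset (Finset A))) (Ss : Set (Finset A))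
    (M : Position A → Set (Finset (Finset A))) : Prop :=
  {Finset.univ} ∈ Ps ∧ ∃ σ : Strategy A,
    (∀ h q, q.1 ∈ Ps → σ h q ∈ M q) ∧ ∀ p, IsPlay σ p → ∃ n, Caught Ss (p n)

/-- The captain has a winning strategy in the captain and robber game on `(Ps, Ss)`. -/
def CaptainWins (Ps : Set (Finset (Finset A))) (Ss : Set (Finset A)) : Prop :=
  HasWinningStrategy Ps Ss (moves Ps)

/-- The captain has a winning strategy in the monotone captain and robber game on `(Ps, Ss)`. -/
def CaptainWinsMonotone (Ps : Set (Finset (Finset A))) (Ss : Set (Finset A)) : Prop :=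
  HasWinningStrategy Ps Ss (monotoneMoves Ps)

/-- The pair `(Ps, Ss)` is monotone. -/
def IsMonotone (Ps : Set (Finset (Finset A))) (Ss : Set (Finset A)) : Prop :=
  CaptainWins Ps Ss ↔ CaptainWinsMonotone Ps Ss

end Game

section Trees

/-- Leaves are the nodes of degree at most one; all other nodes are internal. -/
def IsLeaf {N : Type*} (T : SimpleGraph N) (t : N) : Prop :=
  (T.neighborSet t).ncard ≤ 1

variable {A : Type*} [Fintype A] [DecidableEq A]

open Classical in
/-- The union of the sets `τ l` over the leaves `l` of `T` in the component `C` of `T - t`. -/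
noncomputable def componentLabel {N : Type} (T : SimpleGraph N) (τ : N → Finset A) (t : N)
    (C : (T.induce {u | u ≠ t}).ConnectedComponent) : Finset A :=
  {a | ∃ l, ∃ hl : l ≠ t, IsLeaf T l ∧
    (T.induce {u | u ≠ t}).connectedComponentMk ⟨l, hl⟩ = C ∧ a ∈ τ l}

open Classical in
/-- The set `P_t` of the labels of the components of `T - t`. -/
noncomputable def nodePartition {N : Type} (T : SimpleGraph N) (τ : N → Finset A) (t : N) :
    Finset (Finset A) :=
  {X | ∃ C : (T.induce {u | u ≠ t}).ConnectedComponent, X = componentLabel T τ t C}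

open Classical in
/-- The image of the set of leaves under `τ`. -/
noncomputable def leafLabels {N : Type} (T : SimpleGraph N) (τ : N → Finset A) :
    Finset (Finset A) :=
  {X | ∃ l, IsLeaf T l ∧ τ l = X}

/-- The pair `(Ps, Ss)` has a tree decomposition. Only the values of `τ` at leaves are relevant. -/
def HasTreeDecomposition (Ps : Set (Finset (Finset A))) (Ss : Set (Finset A)) : Prop :=
  ∃ (N : Type) (_ : Finite N) (T : SimpleGraph N) (τ : N → Finset A), T.IsTree ∧
    (∀ l, IsLeaf T l → τ l ∈ Ss) ∧ IsPartition (leafLabels T τ) ∧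
    ∀ t, ¬ IsLeaf T t → nodePartition T τ t ∈ Ps

open Classical in
/-- For an edge `st` of the tree `T` and an assignment `L` of the elements of `A` to nodes: the set
of all elements that lie in the component of `T - st` containing `s`. -/
noncomputable def edgeSide {N : Type} (T : SimpleGraph N) (L : A → N) (s t : N) : Finset A :=
  {a | (T.deleteEdges {s(s, t)}).Reachable s (L a)}

/-- There is a branch decomposition of `f` of width at most `k`: a tree all of whose internal nodes
have degree three, together with a bijection from `A` to its leaves, such that every edge splits `A`
into two sides of value at most `k`. -/
def HasBranchDecomposition (f : Finset A → ℕ) (k : ℕ) : Prop :=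
  ∃ (N : Type) (_ : Finite N) (T : SimpleGraph N) (L : A → N), T.IsTree ∧
    (∀ t, ¬ IsLeaf T t → (T.neighborSet t).ncard = 3) ∧
    Set.BijOn L Set.univ {t | IsLeaf T t} ∧
    ∀ s t, T.Adj s t → f (edgeSide T L s t) ≤ k

/-- The branch-width of `f`, the minimum width of a branch decomposition (it is `0` if `A` has just
one element). -/
noncomputable def branchWidth (f : Finset A → ℕ) : ℕ :=
  sInf {k | HasBranchDecomposition f k}

end Trees

section WidthScenario

variable {A : Type*} [Fintype A] [DecidableEq A]

/-- The partitions `P` of `A` with `∑ X ∈ P, f X ≤ k`. -/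
def part (f : Finset A → ℕ) (k : ℕ) : Set (Finset (Finset A)) :=
  {P | IsPartition P ∧ ∑ X ∈ P, f X ≤ k}

/-- The singletons and the empty set. -/
def sing (A : Type*) : Set (Finset A) :=
  {X | X = ∅ ∨ ∃ a, X = {a}}

/-- The set of all `k` such that `(part f k, sing A)` is a scenario on which the captain has a
winning strategy in the monotone game. -/
def gameBounds (f : Finset A → ℕ) : Set ℕ :=
  {k | IsScenario (part f k) (sing A) ∧ CaptainWinsMonotone (part f k) (sing A)}

/-- The set of all `k` such that `(part f k, sing A)` is a scenario that has a tree
decomposition. -/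
def treeBounds (f : Finset A → ℕ) : Set ℕ :=
  {k | IsScenario (part f k) (sing A) ∧ HasTreeDecomposition (part f k) (sing A)}

/-- The games on the scenarios `(part f k, sing A)` are monotone games that are characterised by
tree decompositions, and the least `k` for which the captain wins approximates `w` within a factor
of three. -/
structure HasFactorThreeMonotoneGame (f : Finset A → ℕ) (w : ℕ) : Prop where
  isScenario : ∀ k, (∀ a, 2 * f {a} ≤ k) → IsScenario (part f k) (sing A)
  isMonotone : ∀ k, IsScenario (part f k) (sing A) → IsMonotone (part f k) (sing A)
  game_iff_tree : ∀ k, IsScenario (part f k) (sing A) →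
    (CaptainWinsMonotone (part f k) (sing A) ↔ HasTreeDecomposition (part f k) (sing A))
  factor_three : ∃ g, IsLeast (gameBounds f) g ∧ IsLeast (treeBounds f) g ∧ w ≤ g ∧ g ≤ 3 * w

end WidthScenario

section GraphParameters

variable {V : Type*} [Fintype V] [DecidableEq V]

open Classical in
/-- The cut-rank function of a graph: the rank over `GF(2)` of the `X × (V \ X)` submatrix of the
adjacency matrix. -/
noncomputable def cutRank (G : SimpleGraph V) (X : Finset V) : ℕ :=
  (Matrix.of fun (x : {v // v ∈ X}) (y : {v // v ∈ Xᶜ}) =>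
    if G.Adj x y then (1 : ZMod 2) else 0).rank

open Classical in
/-- The number of edges of the graph `G` between `X` and `V \ X`. -/
noncomputable def cutSize (G : SimpleGraph V) (X : Finset V) : ℕ :=
  (G.interedges X Xᶜ).card

theorem exists_gf4_generator : ∃ a : GaloisField 2 2, a ≠ 0 ∧ a ≠ 1 := by
  by_contra! h
  have hc : Nat.card (GaloisField 2 2) = 2 ^ 2 := GaloisField.card 2 2 two_ne_zero
  have hu : (Set.univ : Set (GaloisField 2 2)) ⊆ {0, 1} := by
    intro a _
    by_cases ha : a = 0
    · exact Or.inl ha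
    · exact Or.inr (h a ha)
  have h1 := Set.ncard_le_ncard hu (Set.toFinite _)
  have h2 := Set.ncard_insert_le (0 : GaloisField 2 2) {1}
  rw [Set.ncard_univ, hc] at h1
  rw [Set.ncard_singleton] at h2
  omega

/-- A fixed element `a` of `GF(4) = {0, 1, a, a²}` other than `0` and `1`. -/
noncomputable def gf4Generator : GaloisField 2 2 := exists_gf4_generator.choose

open Classical in
/-- The entries of the adjacency matrix over `GF(4)` of a directed graph: `1` for a pair of opposite
arcs, `a` for an arc from `x` to `y` only, `a²` for an arc from `y` to `x` only, and `0` for no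
arc. -/
noncomputable def gf4Entry (D : Digraph V) (x y : V) : GaloisField 2 2 :=
  if D.Adj x y then (if D.Adj y x then 1 else gf4Generator)
  else (if D.Adj y x then gf4Generator ^ 2 else 0)

/-- The `GF(4)`-cut-rank function of a directed graph. -/
noncomputable def gf4CutRank (D : Digraph V) (X : Finset V) : ℕ :=
  (Matrix.of fun (x : {v // v ∈ X}) (y : {v // v ∈ Xᶜ}) => gf4Entry D x y).rank

open Classical in
/-- The bi-cut-rank function of a directed graph: the rank over `GF(2)` of the matrix of the arcs
from `X` to `V \ X`, plus the rank over `GF(2)` of the matrix of the arcs from `V \ X` to `X`. -/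
noncomputable def biCutRank (D : Digraph V) (X : Finset V) : ℕ :=
  (Matrix.of fun (x : {v // v ∈ X}) (y : {v // v ∈ Xᶜ}) =>
    if D.Adj x y then (1 : ZMod 2) else 0).rank +
  (Matrix.of fun (x : {v // v ∈ X}) (y : {v // v ∈ Xᶜ}) =>
    if D.Adj y x then (1 : ZMod 2) else 0).rank

/-- Rank-width of a graph. -/
noncomputable def rankWidth (G : SimpleGraph V) : ℕ := branchWidth (cutRank G)

/-- Carving-width of a graph. -/
noncomputable def carvingWidth (G : SimpleGraph V) : ℕ := branchWidth (cutSize G)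

/-- `GF(4)`-rank-width of a directed graph. -/
noncomputable def gf4RankWidth (D : Digraph V) : ℕ := branchWidth (gf4CutRank D)

/-- Bi-rank-width of a directed graph. -/
noncomputable def biRankWidth (D : Digraph V) : ℕ := branchWidth (biCutRank D)

end GraphParameters

end CaptainRobber

/-! The four functions matter only through `IsConnectivity`: they are symmetric, submodular and zero
on `∅`. For such `f`, both games and tree decompositions are compared with one inductive predicate,
`Winnable`, whose derivations are finite trees of refinements of robber spaces (`captainWins_tfae`).

A win in the unrestricted game yields a derivation by duality. If `univ` is not winnable, enlarge
the simple sets to a maximal down-closed family `L` into which `univ` is still not winnable. The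
sets outside `L` form a haven: otherwise some partition would win into `L` at once, or two disjoint
sets outside `L` would combine to a win into `L`, by re-rooting derivations (`Winnable.reroot`) and
uncrossing along a cut of minimum value (`Winnable.univ_of_disjoint`). A haven lets the robber
escape every strategy, monotone or not.

Conversely, a derivation is a monotone strategy, and a tree decomposition read away from a node is a
derivation. To obtain a tree, a derivation is re-rooted at an element `r`, its partitions are broken
into bisections (`Winnable.splittable`), and the result is laid out as a cubic tree with `r` at the
root.

Every edge of this cubic tree has value at most `k`, so it is also a branch decomposition and `bw(f)
≤ g`. In a branch decomposition of width `w`, the three edges at an internal node cost at most `3 *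
w` together, so `g ≤ 3 * bw(f)`. -/

namespace CaptainRobber

/-! ### Partitions and saturated sets -/

section Duality

variable {A : Type*} [Fintype A] [DecidableEq A]

/-- Every member of `P` lies inside `X` or avoids `X`. -/
def Saturated (P : Finset (Finset A)) (X : Finset A) : Prop :=
  ∀ B ∈ P, B ⊆ X ∨ Disjoint B X

theorem IsPartition.exists_mem {P : Finset (Finset A)} (hP : IsPartition P) (a : A) :
    ∃ B ∈ P, a ∈ B := by
  have h : a ∈ P.sup id := by rw [hP.2]; exact Finset.mem_univ a
  simpa [Finset.mem_sup] using h

theorem IsPartition.eq_of_mem {P : Finset (Finset A)} (hP : IsPartition P) {B C : Finset A} {a : A}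
    (hB : B ∈ P) (hC : C ∈ P) (haB : a ∈ B) (haC : a ∈ C) : B = C := by
  by_contra hne
  exact Finset.disjoint_left.1 (hP.1 B hB C hC hne) haB haC

theorem isPartition_of_existsUnique {P : Finset (Finset A)}
    (h : ∀ a, ∃ B ∈ P, a ∈ B ∧ ∀ C ∈ P, a ∈ C → B = C) : IsPartition P := by
  refine ⟨fun X hX Y hY hne => ?_, ?_⟩
  · rw [Finset.disjoint_left]
    intro a haX haY
    obtain ⟨B, -, -, hB⟩ := h a
    exact hne ((hB X hX haX).symm.trans (hB Y hY haY))
  · ext a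
    obtain ⟨B, hB, haB, -⟩ := h a
    simp only [Finset.mem_univ, iff_true, Finset.mem_sup]
    exact ⟨B, hB, haB⟩

theorem IsPartition.pair (X : Finset A) : IsPartition ({X, Xᶜ} : Finset (Finset A)) := by
  refine isPartition_of_existsUnique fun a => ?_
  by_cases ha : a ∈ X
  · exact ⟨X, by simp, ha, by simp [ha]⟩
  · exact ⟨Xᶜ, by simp, by simp [ha], by simp [ha]⟩

theorem IsPartition.triple {X Y : Finset A} (h : Disjoint X Y) :
    IsPartition ({X, Y, (X ∪ Y)ᶜ} : Finset (Finset A)) := by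
  refine isPartition_of_existsUnique fun a => ?_
  rw [Finset.disjoint_left] at h
  by_cases ha : a ∈ X
  · exact ⟨X, by simp, ha, by simp [ha, h ha]⟩
  · by_cases hb : a ∈ Y
    · exact ⟨Y, by simp, hb, by simp [ha, hb]⟩
    · exact ⟨(X ∪ Y)ᶜ, by simp, by simp [ha, hb], by simp [ha, hb]⟩

omit [DecidableEq A] in
theorem saturated_univ (P : Finset (Finset A)) : Saturated P Finset.univ :=
  fun _ _ => Or.inl (Finset.subset_univ _)

theorem Saturated.compl {P : Finset (Finset A)} {X : Finset A} (h : Saturated P X) :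
    Saturated P Xᶜ := by
  intro B hB
  rcases h B hB with h | h
  · exact Or.inr (disjoint_compl_right.mono_left h)
  · exact Or.inl (Finset.subset_compl_iff_disjoint_right.2 h)

theorem IsPartition.saturated_of_mem {P : Finset (Finset A)} (hP : IsPartition P) {X : Finset A}
    (hX : X ∈ P) : Saturated P X := by
  intro B hB
  by_cases h : B = X
  · exact Or.inl h.subset
  · exact Or.inr (hP.1 B hB X hX h)

theorem IsPartition.saturated_sup {P R : Finset (Finset A)} (hP : IsPartition P) (hR : R ⊆ P) :
    Saturated P (R.sup id) := by
  intro B hB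
  by_cases h : B ∈ R
  · exact Or.inl (Finset.le_sup (f := id) h)
  · right
    rw [Finset.disjoint_sup_right]
    intro C hC
    exact hP.1 B hB C (hR hC) fun h' => h (h' ▸ hC)

theorem Saturated.sup_filter {P : Finset (Finset A)} (hP : IsPartition P) {X : Finset A}
    (h : Saturated P X) : (P.filter (· ⊆ X)).sup id = X := by
  ext a
  simp only [Finset.mem_sup, Finset.mem_filter, id]
  constructor
  · rintro ⟨B, ⟨-, hBX⟩, ha⟩
    exact hBX ha
  · intro ha
    obtain ⟨B, hB, haB⟩ := hP.exists_mem a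
    refine ⟨B, ⟨hB, ?_⟩, haB⟩
    exact (h B hB).resolve_right fun hd => Finset.disjoint_left.1 hd haB ha

/-- The empty set is always saturated, but it is a union in the sense of `IsUnionOf` only if it is a
member of `P`; hence the nonemptiness. -/
theorem Saturated.isUnionOf {P : Finset (Finset A)} (hP : IsPartition P) {X : Finset A}
    (h : Saturated P X) (hX : X.Nonempty) : IsUnionOf X P := by
  refine ⟨P.filter (· ⊆ X), Finset.filter_subset _ _, ?_, (h.sup_filter hP).symm⟩
  rw [Finset.nonempty_iff_ne_empty]
  intro h0
  have := h.sup_filter hP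
  rw [h0, Finset.sup_empty] at this
  exact hX.ne_empty this.symm

theorem IsUnionOf.saturated {P : Finset (Finset A)} (hP : IsPartition P) {X : Finset A}
    (h : IsUnionOf X P) : Saturated P X := by
  obtain ⟨R, hR, -, rfl⟩ := h
  exact hP.saturated_sup hR

/-! ### Connectivity functions and the cost of partitions -/

/-- Symmetric submodular functions that vanish on the empty set. -/
structure IsConnectivity (f : Finset A → ℕ) : Prop where
  map_empty : f ∅ = 0
  map_compl : ∀ X, f Xᶜ = f X
  submodular : ∀ X Y, f (X ∪ Y) + f (X ∩ Y) ≤ f X + f Y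

variable {f : Finset A → ℕ} {k : ℕ}

theorem IsConnectivity.map_sup_le (hf : IsConnectivity f) (R : Finset (Finset A)) :
    f (R.sup id) ≤ ∑ B ∈ R, f B := by
  induction R using Finset.induction_on with
  | empty => simp [hf.map_empty]
  | insert B R hB ih =>
    rw [Finset.sup_insert, Finset.sum_insert hB]
    have := hf.submodular B (R.sup id)
    simp only [id, Finset.sup_eq_union]
    omega

theorem IsConnectivity.le_sum_filter (hf : IsConnectivity f) {P : Finset (Finset A)}
    (hP : IsPartition P) {X : Finset A} (h : Saturated P X) :
    f X ≤ ∑ B ∈ P.filter (· ⊆ X), f B := by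
  conv_lhs => rw [← h.sup_filter hP]
  exact hf.map_sup_le _

theorem sum_insert_le {ι : Type*} [DecidableEq ι] (g : ι → ℕ) (i : ι) (s : Finset ι) :
    ∑ j ∈ insert i s, g j ≤ g i + ∑ j ∈ s, g j := by
  by_cases h : i ∈ s
  · rw [Finset.insert_eq_of_mem h]; omega
  · rw [Finset.sum_insert h]

theorem sum_image_le {ι κ : Type*} [DecidableEq κ] (g : κ → ℕ) (φ : ι → κ) (s : Finset ι) :
    ∑ j ∈ s.image φ, g j ≤ ∑ i ∈ s, g (φ i) := by
  rw [← Finset.sum_fiberwise_of_maps_to (g := φ) (t := s.image φ)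
    (fun i hi => Finset.mem_image_of_mem φ hi)]
  refine Finset.sum_le_sum fun j hj => ?_
  obtain ⟨i, hi, rfl⟩ := Finset.mem_image.1 hj
  exact Finset.single_le_sum (f := fun i => g (φ i)) (fun _ _ => Nat.zero_le _)
    (Finset.mem_filter.2 ⟨hi, rfl⟩)

/-- Merging blocks does not raise the cost, because `f` is subadditive on unions. -/
theorem part_of_saturated (hf : IsConnectivity f) {P Q : Finset (Finset A)} (hP : P ∈ part f k)
    (hQ : IsPartition Q) (h : ∀ X ∈ Q, X.Nonempty → Saturated P X) : Q ∈ part f k := by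
  refine ⟨hQ, le_trans ?_ hP.2⟩
  calc ∑ X ∈ Q, f X = ∑ X ∈ Q.filter (·.Nonempty), f X := by
        refine (Finset.sum_filter_of_ne fun X _ hX => ?_).symm
        rw [Finset.nonempty_iff_ne_empty]
        rintro rfl
        exact hX hf.map_empty
    -- The empty block lies in every `X`; leaving it out makes the families of blocks below
    -- different `X` disjoint.
    _ ≤ ∑ X ∈ Q.filter (·.Nonempty), ∑ B ∈ P.filter (fun B => B.Nonempty ∧ B ⊆ X), f B := by
        refine Finset.sum_le_sum fun X hX => ?_
        rw [Finset.mem_filter] at hX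
        refine (hf.le_sum_filter hP.1 (h X hX.1 hX.2)).trans (le_of_eq ?_)
        refine (Finset.sum_subset (fun B hB => ?_) fun B hB hB' => ?_).symm
        · rw [Finset.mem_filter] at hB ⊢
          exact ⟨hB.1, hB.2.2⟩
        · rw [Finset.mem_filter] at hB hB'
          have : B = ∅ := by
            by_contra hne
            exact hB' ⟨hB.1, Finset.nonempty_iff_ne_empty.2 hne, hB.2⟩
          rw [this, hf.map_empty]
    _ = ∑ B ∈ (Q.filter (·.Nonempty)).biUnion
          (fun X => P.filter (fun B => B.Nonempty ∧ B ⊆ X)), f B := by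
        refine (Finset.sum_biUnion ?_).symm
        intro X hX Y hY hne
        rw [Function.onFun, Finset.disjoint_left]
        intro B hB hB'
        simp only [Finset.coe_filter, Set.mem_ofPred_eq, Finset.mem_filter] at hX hY hB hB'
        obtain ⟨a, ha⟩ := hB.2.1
        exact hne (hQ.eq_of_mem hX.1 hY.1 (hB.2.2 ha) (hB'.2.2 ha))
    _ ≤ ∑ B ∈ P, f B := by
        refine Finset.sum_le_sum_of_subset fun B hB => ?_
        simp only [Finset.mem_biUnion, Finset.mem_filter] at hB
        obtain ⟨_, _, hB, _⟩ := hB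
        exact hB

/-- The blocks inside `Zᶜ` cost at least `f Zᶜ = f Z`, so they may be replaced by the single block
`Zᶜ`. -/
theorem sum_filter_add_le (hf : IsConnectivity f) {P : Finset (Finset A)} (hP : P ∈ part f k)
    {Z : Finset A} (hZ : Saturated P Z) : f Z + ∑ B ∈ P.filter (· ⊆ Z), f B ≤ k := by
  have h1 := hf.le_sum_filter hP.1 hZ.compl
  rw [hf.map_compl] at h1
  have h2 : ∑ B ∈ P.filter (· ⊆ Zᶜ), f B ≤ ∑ B ∈ P.filter (fun B => ¬ B ⊆ Z), f B := by
    rw [← Finset.sum_filter_add_sum_filter_not (P.filter (· ⊆ Zᶜ)) (fun B => B ⊆ Z)]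
    have h0 : ∑ B ∈ (P.filter (· ⊆ Zᶜ)).filter (fun B => B ⊆ Z), f B = 0 := by
      refine Finset.sum_eq_zero fun B hB => ?_
      simp only [Finset.mem_filter] at hB
      have : B = ∅ := by
        rw [← Finset.subset_empty, ← Finset.inter_compl Z]
        exact Finset.subset_inter hB.2 hB.1.2
      rw [this, hf.map_empty]
    rw [h0, zero_add]
    refine Finset.sum_le_sum_of_subset fun B hB => ?_
    simp only [Finset.mem_filter] at hB ⊢
    exact ⟨hB.1.1, hB.2⟩
  have h3 := Finset.sum_filter_add_sum_filter_not P (fun B => B ⊆ Z) f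
  have := hP.2
  omega

/-- The blocks inside `Z` and those outside each cost at least `f Z`. This turns bounds on
partitions into bounds on cuts. -/
theorem two_mul_le_of_saturated (hf : IsConnectivity f) {P : Finset (Finset A)}
    (hP : P ∈ part f k) {Z : Finset A} (hZ : Saturated P Z) : 2 * f Z ≤ k := by
  have h1 := sum_filter_add_le hf hP hZ
  have h2 := hf.le_sum_filter hP.1 hZ
  omega

theorem pair_mem_part (hf : IsConnectivity f) {Z : Finset A} (h : 2 * f Z ≤ k) :
    ({Z, Zᶜ} : Finset (Finset A)) ∈ part f k := by
  refine ⟨IsPartition.pair Z, (sum_insert_le f Z {Zᶜ}).trans ?_⟩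
  rw [Finset.sum_singleton, hf.map_compl]
  omega

theorem insert_compl_filter_mem_part (hf : IsConnectivity f) {P : Finset (Finset A)}
    (hP : P ∈ part f k) {Z : Finset A} (hZ : Saturated P Z) :
    insert Zᶜ (P.filter (· ⊆ Z)) ∈ part f k := by
  refine ⟨isPartition_of_existsUnique fun a => ?_, (sum_insert_le f _ _).trans ?_⟩
  · by_cases ha : a ∈ Z
    · obtain ⟨B, hB, haB⟩ := hP.1.exists_mem a
      refine ⟨B, ?_, haB, ?_⟩
      · refine Finset.mem_insert_of_mem (Finset.mem_filter.2 ⟨hB, ?_⟩)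
        exact (hZ B hB).resolve_right fun hd => Finset.disjoint_left.1 hd haB ha
      · intro C hC haC
        rcases Finset.mem_insert.1 hC with rfl | hC
        · simp [ha] at haC
        · exact hP.1.eq_of_mem hB (Finset.mem_filter.1 hC).1 haB haC
    · refine ⟨Zᶜ, Finset.mem_insert_self _ _, by simp [ha], ?_⟩
      intro C hC haC
      rcases Finset.mem_insert.1 hC with rfl | hC
      · rfl
      · exact absurd ((Finset.mem_filter.1 hC).2 haC) ha
  · rw [hf.map_compl]
    exact sum_filter_add_le hf hP hZ

/-! ### Winnable robber spaces: re-rooting and uncrossing -/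

/-- The captain can drive a robber whose space is `X` into a member of `Ls`, using partitions from
`Ps` that refine the robber space. -/
inductive Winnable (Ps : Set (Finset (Finset A))) (Ls : Set (Finset A)) : Finset A → Prop
  | base {X : Finset A} (h : X ∈ Ls) : Winnable Ps Ls X
  | step {X : Finset A} (P : Finset (Finset A)) (hP : P ∈ Ps) (hX : Saturated P X)
      (h : ∀ B ∈ P, B ⊆ X → Winnable Ps Ls B) : Winnable Ps Ls X

variable {Ps : Set (Finset (Finset A))} {Ls : Set (Finset A)}

omit [Fintype A] [DecidableEq A] in
-- All sets in a derivation for `Z` are subsets of `Z`, so a target `X` not inside `Z` is never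
-- used.
theorem Winnable.of_insert {X Z : Finset A} (h : Winnable Ps (insert X Ls) Z) (hX : ¬ X ⊆ Z) :
    Winnable Ps Ls Z := by
  induction h with
  | base h => exact .base (h.resolve_left fun h => hX h.ge)
  | step P hP hZ _ ih => exact .step P hP hZ fun B hB hBZ => ih B hB hBZ fun h => hX (h.trans hBZ)

omit [Fintype A] [DecidableEq A] in
theorem Winnable.mono {Ls' : Set (Finset A)} (hL : Ls ⊆ Ls') {Z : Finset A}
    (h : Winnable Ps Ls Z) : Winnable Ps Ls' Z := by
  induction h with
  | base h => exact .base (hL h)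
  | step P hP hZ _ ih => exact .step P hP hZ ih

theorem Winnable.univ_of_compl (hf : IsConnectivity f) {Z : Finset A} (hk : 2 * f Z ≤ k)
    (h : Winnable (part f k) Ls Z) (h' : Winnable (part f k) Ls Zᶜ) :
    Winnable (part f k) Ls Finset.univ := by
  refine .step _ (pair_mem_part hf hk) (saturated_univ _) fun B hB _ => ?_
  rcases Finset.mem_insert.1 hB with rfl | hB
  · exact h
  · rwa [Finset.mem_singleton.1 hB]

/-- Walk down the derivation towards a leaf `X`, keeping the complement of the current set winnable:
from the complement of a child, the captain moves to the other children and to the complement of the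
parent. Since `X` is nonempty, at most one child contains it. If none does, the target `X` is not
needed below this point and `univ` is winnable without it. -/
theorem Winnable.reroot (hf : IsConnectivity f) {X Z : Finset A} (hX : X.Nonempty)
    (h : Winnable (part f k) (insert X Ls) Z) (hZ : Winnable (part f k) Ls Zᶜ)
    (hk : 2 * f Z ≤ k) :
    Winnable (part f k) Ls Finset.univ ∨ (Winnable (part f k) Ls Xᶜ ∧ 2 * f X ≤ k) := by
  induction h with
  | base h =>
    rcases h with rfl | h
    · exact Or.inr ⟨hZ, hk⟩
    · exact Or.inl ((Winnable.base h).univ_of_compl hf hk hZ)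
  | @step Z P hP hs hw ih =>
    by_cases hB : ∃ B ∈ P, B ⊆ Z ∧ X ⊆ B
    · obtain ⟨B, hB, hBZ, hXB⟩ := hB
      refine ih B hB hBZ ?_ (two_mul_le_of_saturated hf hP (hP.1.saturated_of_mem hB))
      have hQ := insert_compl_filter_mem_part hf hP hs
      have hBQ : B ∈ insert Zᶜ (P.filter (· ⊆ Z)) :=
        Finset.mem_insert_of_mem (Finset.mem_filter.2 ⟨hB, hBZ⟩)
      refine .step _ hQ (hQ.1.saturated_of_mem hBQ).compl fun C hC hCB => ?_
      rcases Finset.mem_insert.1 hC with rfl | hC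
      · exact hZ
      · rw [Finset.mem_filter] at hC
        refine (hw C hC.1 hC.2).of_insert fun hXC => ?_
        obtain ⟨a, ha⟩ := hX
        exact Finset.mem_compl.1 (hCB (hXC ha)) (hXB ha)
    · push Not at hB
      left
      refine Winnable.univ_of_compl hf hk ?_ hZ
      exact .step P hP hs fun B hBP hBZ => (hw B hBP hBZ).of_insert (hB B hBP hBZ)

/-- Apply submodularity to `Z` and `Fᶜ`. The complement of their union is `Zᶜ ∩ F`, which still
contains `X` and so costs at least `f F`. -/
theorem IsConnectivity.map_sdiff_le (hf : IsConnectivity f) {X F Z : Finset A} (hXF : X ⊆ F)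
    (hF : ∀ Y, X ⊆ Y → Y ⊆ F → f F ≤ f Y) (hZ : Disjoint Z X) : f (Z \ F) ≤ f Z := by
  have h1 := hf.submodular Z Fᶜ
  have h2 := hF (Zᶜ ∩ F) (Finset.subset_inter (Finset.subset_compl_iff_disjoint_left.2 hZ) hXF)
    Finset.inter_subset_right
  have h3 : (Z ∪ Fᶜ) = (Zᶜ ∩ F)ᶜ := by simp [Finset.compl_inter]
  rw [h3, hf.map_compl, hf.map_compl, ← Finset.sdiff_eq_inter_compl] at h1
  omega

/-- Deleting `F` from all sets of a derivation makes none of them more expensive, by `map_sdiff_le`,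
and keeps the targets in the down-closed family `Ls`. -/
theorem Winnable.sdiff (hf : IsConnectivity f) (hL : ∀ Y ∈ Ls, ∀ Z ⊆ Y, Z ∈ Ls)
    (h0 : ∅ ∈ Ls) {X F Z : Finset A} (hXF : X ⊆ F) (hF : ∀ Y, X ⊆ Y → Y ⊆ F → f F ≤ f Y)
    (hZ : Disjoint Z X) (h : Winnable (part f k) Ls Z) : Winnable (part f k) Ls (Z \ F) := by
  induction h with
  | base h => exact .base (hL _ h _ Finset.sdiff_subset)
  | @step Z P hP hs hw ih =>
    -- The blocks outside `Z` are merged with `F` into a single block, paid for by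
    -- `sum_filter_add_le`; the blocks inside `Z` lose `F`.
    have hQ : insert (Z \ F)ᶜ ((P.filter (· ⊆ Z)).image (· \ F)) ∈ part f k := by
      refine ⟨isPartition_of_existsUnique fun a => ?_, ?_⟩
      · by_cases ha : a ∈ Z \ F
        · rw [Finset.mem_sdiff] at ha
          obtain ⟨B, hB, haB⟩ := hP.1.exists_mem a
          refine ⟨B \ F, ?_, by simp [haB, ha.2], ?_⟩
          · refine Finset.mem_insert_of_mem (Finset.mem_image_of_mem _
              (Finset.mem_filter.2 ⟨hB, ?_⟩))
            exact (hs B hB).resolve_right fun hd => Finset.disjoint_left.1 hd haB ha.1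
          · intro C hC haC
            rcases Finset.mem_insert.1 hC with rfl | hC
            · simp [ha] at haC
            · obtain ⟨C, hCP, rfl⟩ := Finset.mem_image.1 hC
              rw [hP.1.eq_of_mem hB (Finset.mem_filter.1 hCP).1 haB (Finset.mem_sdiff.1 haC).1]
        · refine ⟨(Z \ F)ᶜ, Finset.mem_insert_self _ _, by rwa [Finset.mem_compl], ?_⟩
          intro C hC haC
          rcases Finset.mem_insert.1 hC with rfl | hC
          · rfl
          · obtain ⟨C, hCP, rfl⟩ := Finset.mem_image.1 hC
            exact absurd (Finset.sdiff_subset_sdiff (Finset.mem_filter.1 hCP).2 subset_rfl haC) ha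
      · refine (sum_insert_le f _ _).trans (le_trans ?_ (sum_filter_add_le hf hP hs))
        rw [hf.map_compl]
        refine add_le_add (hf.map_sdiff_le hXF hF hZ) ((sum_image_le f _ _).trans ?_)
        exact Finset.sum_le_sum fun B hB =>
          hf.map_sdiff_le hXF hF (hZ.mono_left (Finset.mem_filter.1 hB).2)
    have hs' := (hQ.1.saturated_of_mem (Finset.mem_insert_self _ _)).compl
    rw [compl_compl] at hs'
    refine .step _ hQ hs' fun C hC hCZ => ?_
    rcases Finset.mem_insert.1 hC with rfl | hC
    -- The merged block lies inside its own complement only if it is empty.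
    · have : (Z \ F)ᶜ = ∅ := by
        rw [← Finset.subset_empty, ← Finset.inter_compl (Z \ F)]
        exact Finset.subset_inter hCZ subset_rfl
      rw [this]
      exact .base h0
    · obtain ⟨B, hB, rfl⟩ := Finset.mem_image.1 hC
      rw [Finset.mem_filter] at hB
      exact ih B hB.1 hB.2 (hZ.mono_left hB.2)

/-! ### Havens -/

/-- A haven of the robber: pairwise intersecting sets, none of them in `Ss`, that meet every member
of `Ps` in a block. -/
def IsHaven (Ps : Set (Finset (Finset A))) (Ss : Set (Finset A)) (H : Set (Finset A)) : Prop :=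
  (∀ P ∈ Ps, ∃ X ∈ P, X ∈ H) ∧ (∀ X ∈ H, ∀ Y ∈ H, ¬ Disjoint X Y) ∧ ∀ X ∈ H, X ∉ Ss

/-- Two disjoint parts that can be reached from outside suffice to win everywhere. -/
theorem Winnable.univ_of_disjoint (hf : IsConnectivity f) (hL : ∀ Y ∈ Ls, ∀ Z ⊆ Y, Z ∈ Ls)
    (h0 : ∅ ∈ Ls) {X Y : Finset A} (hXY : Disjoint X Y) (hk : 2 * f X ≤ k)
    (hX : Winnable (part f k) Ls Xᶜ) (hY : Winnable (part f k) Ls Yᶜ) :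
    Winnable (part f k) Ls Finset.univ := by
  -- `F` is a cheapest cut separating `X` from `Y`. By symmetry of `f`, `Fᶜ` is minimal as seen from
  -- `Y`, so both derivations can be uncrossed with it; and `2 * f F ≤ 2 * f X ≤ k` permits the
  -- partition `{F, Fᶜ}`.
  obtain ⟨F, hF, hmin⟩ := Finset.exists_min_image (Finset.Icc X Yᶜ) f
    ⟨X, Finset.left_mem_Icc.2 (Finset.subset_compl_iff_disjoint_right.2 hXY)⟩
  have hXF : X ⊆ F := (Finset.mem_Icc.1 hF).1
  have hFY : F ⊆ Yᶜ := (Finset.mem_Icc.1 hF).2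
  have hYF : Y ⊆ Fᶜ := Finset.subset_compl_comm.1 hFY
  have h1 := hX.sdiff hf hL h0 hXF
    (fun Z hXZ hZF => hmin Z (Finset.mem_Icc.2 ⟨hXZ, hZF.trans hFY⟩)) disjoint_compl_left
  have h2 := hY.sdiff hf hL h0 hYF (fun Z hYZ hZF => by
    rw [hf.map_compl, ← hf.map_compl Z]
    exact hmin Zᶜ (Finset.mem_Icc.2 ⟨hXF.trans (Finset.subset_compl_comm.1 hZF),
      Finset.compl_subset_compl.2 hYZ⟩)) disjoint_compl_left
  have e1 : Xᶜ \ F = Fᶜ := by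
    rw [Finset.sdiff_eq_inter_compl]
    exact Finset.inter_eq_right.2 (Finset.compl_subset_compl.2 hXF)
  have e2 : Yᶜ \ Fᶜ = F := by
    rw [Finset.sdiff_eq_inter_compl, compl_compl]
    exact Finset.inter_eq_right.2 hFY
  rw [e1] at h1
  rw [e2] at h2
  refine h2.univ_of_compl hf ?_ h1
  have := hmin X (Finset.left_mem_Icc.2 (hXF.trans hFY))
  omega

theorem exists_isHaven_of_not_winnable (hf : IsConnectivity f) {Ss : Set (Finset A)}
    (hS : ∀ Y ∈ Ss, ∀ Z ⊆ Y, Z ∈ Ss) (h0 : ∅ ∈ Ss)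
    (h : ¬ Winnable (part f k) Ss Finset.univ) : ∃ H, IsHaven (part f k) Ss H := by
  let F : Set (Set (Finset A)) :=
    {L | (∀ Y ∈ L, ∀ Z ⊆ Y, Z ∈ L) ∧ ¬ Winnable (part f k) L Finset.univ}
  obtain ⟨L, hSL, hLmax⟩ := (Set.toFinite F).exists_le_maximal (a := Ss) ⟨hS, h⟩
  have hL := hLmax.prop.1
  have hLw := hLmax.prop.2
  -- A minimal set `X'` outside `L` can be added to `L` without losing down-closure. By maximality
  -- `univ` then becomes winnable, and re-rooting at `X'` gives the claim.
  have key : ∀ X, X ∉ L → ∃ X' ⊆ X, 2 * f X' ≤ k ∧ Winnable (part f k) L X'ᶜ := by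
    intro X hX
    obtain ⟨X', hX'X, hmin⟩ := exists_minimal_le_of_wellFoundedLT (· ∉ L) X hX
    refine ⟨X', hX'X, ?_⟩
    have hne : X'.Nonempty := by
      rw [Finset.nonempty_iff_ne_empty]
      rintro rfl
      exact hmin.prop (hSL h0)
    have hw : Winnable (part f k) (insert X' L) Finset.univ := by
      by_contra hw
      have hF : insert X' L ∈ F := by
        refine ⟨fun Y hY Z hZ => ?_, hw⟩
        rcases hY with rfl | hY
        · by_contra hZL
          rw [Set.mem_insert_iff, not_or] at hZL
          exact hZL.1 (subset_antisymm hZ (hmin.le_of_le hZL.2 hZ))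
        · exact Set.mem_insert_of_mem _ (hL Y hY Z hZ)
      exact hmin.prop (hLmax.le_of_ge hF (Set.subset_insert _ _) (Set.mem_insert _ _))
    rcases hw.reroot hf hne (.base (by simpa using hSL h0))
      (by rw [← hf.map_compl, Finset.compl_univ, hf.map_empty]; omega) with h | h
    · exact absurd h hLw
    · exact ⟨h.2, h.1⟩
  refine ⟨Lᶜ, fun P hP => ?_, fun X hX Y hY hd => ?_, fun X hX hXS => hX (hSL hXS)⟩
  · by_contra! hPL
    exact hLw (.step P hP (saturated_univ P) fun B hB _ => .base (by simpa using hPL B hB))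
  · obtain ⟨X', hX', hk, hwX⟩ := key X hX
    obtain ⟨Y', hY', -, hwY⟩ := key Y hY
    exact hLw (Winnable.univ_of_disjoint hf hL (hSL h0) ((hd.mono_left hX').mono_right hY') hk
      hwX hwY)

omit [Fintype A] [DecidableEq A] in
theorem mem_sing_of_subset {X Y : Finset A} (hY : Y ∈ sing A) (hXY : X ⊆ Y) : X ∈ sing A := by
  rcases hY with rfl | ⟨a, rfl⟩
  · exact Or.inl (Finset.subset_empty.1 hXY)
  · exact (Finset.subset_singleton_iff.1 hXY).imp id fun h => ⟨a, h⟩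

theorem IsConnectivity.isScenario (hf : IsConnectivity f) (h : ∀ a, 2 * f {a} ≤ k) :
    IsScenario (part f k) (sing A) where
  isPartition P hP := hP.1
  coarser_mem P hP Q hQ hQP :=
    part_of_saturated hf hP hQ fun X hX _ => (hQP X hX).saturated hP.1
  subset_mem S hS X hX _ := mem_sing_of_subset hS hX
  pair_mem S hS := by
    refine pair_mem_part hf ?_
    rcases hS with rfl | ⟨a, rfl⟩
    · rw [hf.map_empty]; omega
    · exact h a

end Duality

/-! ### From havens and derivations to strategies -/

section Strategies

variable {A : Type*} [Fintype A] [DecidableEq A]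
variable {Ps : Set (Finset (Finset A))} {Ss : Set (Finset A)}

theorem CaptainWinsMonotone.captainWins (h : CaptainWinsMonotone Ps Ss) : CaptainWins Ps Ss := by
  obtain ⟨hu, σ, hσ, hw⟩ := h
  exact ⟨hu, σ, fun h q hq => (hσ h q hq).1, hw⟩

/-- Take a minimal `Y ⊇ X` saturated for both partitions. A smaller common union `Z` would either
contain `X` or leave the smaller candidate `Y \ Z`. -/
theorem exists_mem_commonCoarsening {P Q : Finset (Finset A)} (hP : IsPartition P)
    (hQ : IsPartition Q) {X : Finset A} (hX : X ∈ P) (hne : X.Nonempty) :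
    ∃ Y ∈ commonCoarsening P Q, X ⊆ Y := by
  obtain ⟨Y, -, hY⟩ := exists_minimal_le_of_wellFoundedLT
    (fun Y : Finset A => X ⊆ Y ∧ Saturated P Y ∧ Saturated Q Y) Finset.univ
    ⟨Finset.subset_univ _, saturated_univ _, saturated_univ _⟩
  obtain ⟨hXY, hPY, hQY⟩ := hY.prop
  have hYne := hne.mono hXY
  refine ⟨Y, ⟨hPY.isUnionOf hP hYne, hQY.isUnionOf hQ hYne, ?_⟩, hXY⟩
  intro Z hZY hZ hPZ hQZ
  have hPZ := hPZ.saturated hP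
  have hQZ := hQZ.saturated hQ
  rcases hPZ X hX with h | h
  · exact subset_antisymm hZY (hY.le_of_le ⟨h, hPZ, hQZ⟩ hZY)
  · have hs : ∀ R : Finset (Finset A), Saturated R Y → Saturated R Z → Saturated R (Y \ Z) := by
      intro R hRY hRZ B hB
      rcases hRZ B hB with h' | h'
      · exact Or.inr (Finset.disjoint_sdiff.mono_left h')
      · rcases hRY B hB with h'' | h''
        · exact Or.inl (Finset.subset_sdiff.2 ⟨h'', h'⟩)
        · exact Or.inr (h''.mono_right Finset.sdiff_subset)
    have hle : Y ⊆ Y \ Z := hY.le_of_le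
      ⟨Finset.subset_sdiff.2 ⟨hXY, h⟩, hs P hPY hPZ, hs Q hQY hQZ⟩ Finset.sdiff_subset
    obtain ⟨a, ha⟩ := hZ
    exact absurd ha (Finset.mem_sdiff.1 (hle (hZY ha))).2

/-- The robber always stays in the haven block of the current partition. Consecutive haven blocks
intersect, so the new one lies in the block of the common coarsening in which he may run. -/
theorem IsHaven.not_captainWins (hPs : ∀ P ∈ Ps, IsPartition P) {H : Set (Finset A)}
    (hH : IsHaven Ps Ss H) : ¬ CaptainWins Ps Ss := by
  rintro ⟨hu, σ, hσ, hwin⟩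
  obtain ⟨hblk, hint, hS⟩ := hH
  choose! blk hblkP hblkH using hblk
  have hne : ∀ P ∈ Ps, (blk P).Nonempty := fun P hP => by
    rw [Finset.nonempty_iff_ne_empty]
    intro h0
    have := hint _ (hblkH P hP) _ (hblkH P hP)
    rw [h0] at this
    exact this (Finset.disjoint_empty_left _)
  have hA : Nonempty A := ⟨(hne _ hu).choose⟩
  choose! pick hpick using hne
  -- The state carries the history along, because the captain's strategy may depend on it.
  let step : List (Position A) × Finset (Finset A) → List (Position A) × Finset (Finset A) :=
    fun s => (s.1 ++ [(s.2, pick s.2)], σ s.1 (s.2, pick s.2))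
  let s : ℕ → List (Position A) × Finset (Finset A) := fun n => step^[n] ([], {Finset.univ})
  let p : ℕ → Position A := fun n => ((s n).2, pick (s n).2)
  have hs : ∀ n, s (n + 1) = step (s n) := fun n => Function.iterate_succ_apply' _ _ _
  have hlist : ∀ n, (s n).1 = (List.range n).map p := by
    intro n
    induction n with
    | zero => rfl
    | succ n ih => rw [hs, List.range_succ, List.map_append, ← ih]; rfl
  have hmem : ∀ n, (s n).2 ∈ Ps := by
    intro n
    induction n with
    | zero => exact hu
    | succ n ih => rw [hs]; exact hσ _ _ ih
  have hplay : IsPlay σ p := by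
    refine ⟨rfl, fun n => ⟨?_, ?_⟩⟩
    · rw [← hlist]
      change (s (n + 1)).2 = _
      rw [hs]
    · have h1 := hmem n
      have h2 := hmem (n + 1)
      obtain ⟨Y, hY, hsub⟩ := exists_mem_commonCoarsening (hPs _ h1) (hPs _ h2) (hblkP _ h1)
        ⟨_, hpick _ h1⟩
      refine ⟨blk (s n).2, hblkP _ h1, hpick _ h1, Y, hY, hsub, ?_⟩
      refine (((hY.2.1).saturated (hPs _ h2)) _ (hblkP _ h2)).resolve_right ?_ (hpick _ h2)
      exact fun hd => hint _ (hblkH _ h2) _ (hblkH _ h1) (hd.mono_right hsub)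
  obtain ⟨n, X, hX, hrX, hXS⟩ := hwin p hplay
  have := (hPs _ (hmem n)).eq_of_mem hX (hblkP _ (hmem n)) hrX (hpick _ (hmem n))
  exact hS _ (hblkH _ (hmem n)) (this ▸ hXS)

omit [Fintype A] [DecidableEq A] in
-- A partition having `X` itself as a block makes no progress; skipping such steps leaves one that
-- properly shrinks the robber space.
theorem Winnable.progress {X : Finset A} (h : Winnable Ps Ss X) :
    X ∈ Ss ∨ ∃ P ∈ Ps, Saturated P X ∧ ∀ B ∈ P, B ⊆ X → B ≠ X ∧ Winnable Ps Ss B := by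
  induction h with
  | base h => exact Or.inl h
  | @step X P hP hX hw ih =>
    by_cases hXP : X ∈ P
    · exact ih X hXP subset_rfl
    · exact Or.inr ⟨P, hP, hX, fun B hB hBX => ⟨fun h => hXP (h ▸ hB), hw B hB hBX⟩⟩

/-- A memoryless strategy suffices. Since the new partition refines the robber space `X`, the set
`X` is a block of the common coarsening and the robber cannot leave it. -/
theorem Winnable.captainWinsMonotone (hPs : ∀ P ∈ Ps, IsPartition P) (hu : {Finset.univ} ∈ Ps)
    (h : Winnable Ps Ss Finset.univ) : CaptainWinsMonotone Ps Ss := by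
  have hmove : ∀ q : Position A, ∃ P' : Finset (Finset A), q.1 ∈ Ps → (P' ∈ monotoneMoves Ps q ∧
      ∀ X ∈ q.1, q.2 ∈ X → Winnable Ps Ss X → X ∉ Ss →
        ∀ B ∈ P', B ⊆ X → B ≠ X ∧ Winnable Ps Ss B) := by
    intro q
    by_cases hq : q.1 ∈ Ps
    · obtain ⟨X, hX, hqX⟩ := (hPs _ hq).exists_mem q.2
      have huniq : ∀ Y ∈ q.1, q.2 ∈ Y → Y = X :=
        fun Y hY hqY => (hPs _ hq).eq_of_mem hY hX hqY hqX
      by_cases hw : Winnable Ps Ss X ∧ X ∉ Ss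
      · obtain ⟨P, hP, hsat, hB⟩ := hw.1.progress.resolve_left hw.2
        refine ⟨P, fun _ => ⟨⟨hP, fun Y hY hqY => ?_⟩, fun Y hY hqY _ _ => ?_⟩⟩
        · exact huniq Y hY hqY ▸ hsat.isUnionOf (hPs _ hP) ⟨_, hqX⟩
        · exact huniq Y hY hqY ▸ hB
      -- Where nothing is to be gained, repeating the current partition is a legal monotone move.
      · refine ⟨q.1, fun _ => ⟨⟨hq, fun Y hY hqY => ?_⟩, fun Y hY hqY hYw hYS => ?_⟩⟩
        · exact ((hPs _ hq).saturated_of_mem hY).isUnionOf (hPs _ hq) ⟨_, hqY⟩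
        · exact absurd (huniq Y hY hqY ▸ ⟨hYw, hYS⟩) hw
    · exact ⟨∅, fun h => absurd h hq⟩
  choose σ hσ using hmove
  refine ⟨hu, fun _ q => σ q, fun _ q hq => (hσ q hq).1, fun p hp => ?_⟩
  by_contra! hc
  -- The robber space loses an element in every round, so after `Fintype.card A` rounds it would be
  -- empty, although it contains the robber.
  have key : ∀ n, (p n).1 ∈ Ps ∧ ∃ X ∈ (p n).1, (p n).2 ∈ X ∧ Winnable Ps Ss X ∧
      X.card + n ≤ Fintype.card A := by
    intro n
    induction n with
    | zero =>
      rw [hp.1]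
      exact ⟨hu, Finset.univ, Finset.mem_singleton_self _, Finset.mem_univ _, h, le_rfl⟩
    | succ n ih =>
      obtain ⟨hPn, X, hX, hrX, hw, hcard⟩ := ih
      obtain ⟨⟨hP', hunion⟩, hdown⟩ := hσ (p n) hPn
      obtain ⟨heq, X', hX', hrX', Y, hY, hXY, hrY⟩ := hp.2 n
      rw [heq] at hY ⊢
      obtain rfl : X' = X := (hPs _ hPn).eq_of_mem hX' hX hrX' hrX
      have hYX : X' = Y := hY.2.2 X' hXY ⟨_, hrX⟩
        (((hPs _ hPn).saturated_of_mem hX).isUnionOf (hPs _ hPn) ⟨_, hrX⟩) (hunion _ hX hrX)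
      obtain ⟨B, hB, hrB⟩ := (hPs _ hP').exists_mem (p (n + 1)).2
      have hBX : B ⊆ X' := (((hunion _ hX hrX).saturated (hPs _ hP')) B hB).resolve_right
        fun hd => Finset.disjoint_left.1 hd hrB (hYX ▸ hrY)
      obtain ⟨hne, hBw⟩ := hdown X' hX hrX hw (fun hS => hc n ⟨X', hX, hrX, hS⟩) B hB hBX
      have := Finset.card_lt_card (hBX.ssubset_of_ne hne)
      exact ⟨hP', B, hB, hrB, hBw, by omega⟩
  obtain ⟨-, X, -, hr, -, hX⟩ := key (Fintype.card A)
  have := Finset.card_pos.2 ⟨_, hr⟩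
  omega

end Strategies

/-! ### Sides of edges in a tree -/

section Sides

variable {N : Type*} {T : SimpleGraph N}

theorem mem_of_reachable {G : SimpleGraph N} {S : Set N} {s u : N} (h : G.Reachable s u)
    (hs : s ∈ S) (hS : ∀ v w, G.Adj v w → v ∈ S → w ∈ S) : u ∈ S := by
  obtain ⟨p⟩ := h
  induction p with
  | nil => exact hs
  | cons hadj _ ih => exact ih (hS _ _ hadj hs)

/-- The nodes that lie on the side of `s` when the edge `st` is deleted. -/
def side (T : SimpleGraph N) (s t : N) : Set N :=
  {u | (T.deleteEdges {s(s, t)}).Reachable s u}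

theorem self_mem_side (s t : N) : s ∈ side T s t := SimpleGraph.Reachable.refl _

theorem mem_side_of_adj {s t v w : N} (hv : v ∈ side T s t) (h : T.Adj v w)
    (hne : s(v, w) ≠ s(s, t)) : w ∈ side T s t := by
  refine SimpleGraph.Reachable.trans hv (SimpleGraph.Adj.reachable ?_)
  rw [SimpleGraph.deleteEdges_adj]
  exact ⟨h, hne⟩

theorem mem_side_induction {s t u : N} {S : Set N} (h : u ∈ side T s t) (hs : s ∈ S)
    (hS : ∀ v w, T.Adj v w → s(v, w) ≠ s(s, t) → v ∈ side T s t → v ∈ S → w ∈ S) : u ∈ S := by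
  have := mem_of_reachable (S := S ∩ side T s t) h ⟨hs, self_mem_side s t⟩ fun v w hvw hv => by
    rw [SimpleGraph.deleteEdges_adj] at hvw
    exact ⟨hS v w hvw.1 hvw.2 hv.2 hv.1, mem_side_of_adj hv.2 hvw.1 hvw.2⟩
  exact this.1

theorem right_notMem_side (hT : T.IsTree) {s t : N} (h : T.Adj s t) : t ∉ side T s t :=
  SimpleGraph.isBridge_iff.1 (SimpleGraph.isAcyclic_iff_forall_adj_isBridge.1 hT.isAcyclic h)

theorem mem_side_comm (hT : T.IsTree) {s t : N} (h : T.Adj s t) (u : N) :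
    u ∈ side T t s ↔ u ∉ side T s t := by
  constructor
  · intro h1 h2
    refine right_notMem_side hT h (SimpleGraph.Reachable.trans h2 ?_)
    have h1 : (T.deleteEdges {s(t, s)}).Reachable t u := h1
    rw [Sym2.eq_swap] at h1
    exact h1.symm
  · intro hu
    have : u ∈ side T s t ∪ side T t s :=
      mem_of_reachable (hT.connected s u) (Or.inl (self_mem_side s t)) fun v w hvw hv => by
        by_cases he : s(v, w) = s(s, t)
        · rcases Sym2.eq_iff.1 he with ⟨-, rfl⟩ | ⟨-, rfl⟩
          · exact Or.inr (self_mem_side _ _)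
          · exact Or.inl (self_mem_side _ _)
        · rcases hv with hv | hv
          · exact Or.inl (mem_side_of_adj hv hvw he)
          · exact Or.inr (mem_side_of_adj hv hvw (by rwa [Sym2.eq_swap (a := t)]))
    exact this.resolve_left hu

/-- A path from `s` can use the edge `st` only by visiting `t`. This translates components of `T -
t` into sides of edges. -/
theorem reachable_induce_iff (hT : T.IsTree) {s t : N} (h : T.Adj s t) {u : N} (hu : u ≠ t) :
    (T.induce {u | u ≠ t}).Reachable ⟨s, h.ne⟩ ⟨u, hu⟩ ↔ u ∈ side T s t := by
  constructor
  · intro hr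
    refine mem_of_reachable (S := {x : {u | u ≠ t} | x.1 ∈ side T s t}) hr (self_mem_side s t) ?_
    rintro ⟨v, hv⟩ ⟨w, hw⟩ hvw hvs
    refine mem_side_of_adj hvs hvw fun he => ?_
    rcases Sym2.eq_iff.1 he with ⟨-, h⟩ | ⟨h, -⟩
    · exact hw h
    · exact hv h
  · intro hr
    have : u ∈ {u | ∃ hu : u ≠ t, (T.induce {u | u ≠ t}).Reachable ⟨s, h.ne⟩ ⟨u, hu⟩} := by
      refine mem_side_induction hr ⟨h.ne, SimpleGraph.Reachable.refl _⟩ ?_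
      rintro v w hvw he hvs ⟨hv, hrv⟩
      have hw : w ≠ t := by
        rintro rfl
        exact right_notMem_side hT h (mem_side_of_adj hvs hvw he)
      exact ⟨hw, hrv.trans (SimpleGraph.Adj.reachable (by exact hvw))⟩
    exact this.2

theorem exists_mem_side (hT : T.IsTree) {s v : N} (hv : v ≠ s) :
    ∃ u, T.Adj u s ∧ v ∈ side T u s := by
  have : v ∈ {v | v = s ∨ ∃ u, T.Adj u s ∧ v ∈ side T u s} := by
    refine mem_of_reachable (hT.connected s v) (Or.inl rfl) ?_
    rintro v w hvw (rfl | ⟨u, hu, hvu⟩)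
    · exact Or.inr ⟨w, hvw.symm, self_mem_side _ _⟩
    · by_cases hw : w = s
      · exact Or.inl hw
      · refine Or.inr ⟨u, hu, mem_side_of_adj hvu hvw fun he => ?_⟩
        rcases Sym2.eq_iff.1 he with ⟨-, h⟩ | ⟨h, -⟩
        · exact hw h
        · exact right_notMem_side hT hu (h ▸ hvu)
  exact this.resolve_left hv

theorem eq_of_mem_side (hT : T.IsTree) {s u u' v : N} (hu : T.Adj u s) (hu' : T.Adj u' s)
    (h : v ∈ side T u s) (h' : v ∈ side T u' s) : u = u' := by
  by_contra hne
  have hv : v ≠ s := by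
    rintro rfl
    exact right_notMem_side hT hu h
  have h1 := (reachable_induce_iff hT hu hu'.ne).1
    (((reachable_induce_iff hT hu hv).2 h).trans ((reachable_induce_iff hT hu' hv).2 h').symm)
  refine right_notMem_side hT hu (mem_side_of_adj h1 hu' fun he => ?_)
  rcases Sym2.eq_iff.1 he with ⟨h, -⟩ | ⟨h, -⟩
  · exact hne h.symm
  · exact hu'.ne h

theorem mem_side_iff (hT : T.IsTree) {s t : N} (h : T.Adj s t) (v : N) :
    v ∈ side T s t ↔ v = s ∨ ∃ u, T.Adj u s ∧ u ≠ t ∧ v ∈ side T u s := by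
  constructor
  · intro hv
    by_cases hvs : v = s
    · exact Or.inl hvs
    · obtain ⟨u, hu, hvu⟩ := exists_mem_side hT hvs
      refine Or.inr ⟨u, hu, ?_, hvu⟩
      rintro rfl
      exact (mem_side_comm hT h v).1 hvu hv
  · rintro (rfl | ⟨u, hu, hne, hv⟩)
    · exact self_mem_side _ _
    · by_contra hvs
      exact hne (eq_of_mem_side hT hu h.symm hv ((mem_side_comm hT h v).2 hvs))

theorem IsLeaf.eq_of_adj [Finite N] {s t u : N} (hs : IsLeaf T s) (ht : T.Adj t s)
    (hu : T.Adj u s) : t = u :=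
  (Set.ncard_le_one (Set.toFinite _)).1 hs t ht.symm u hu.symm

theorem side_eq_singleton [Finite N] (hT : T.IsTree) {s t : N} (h : T.Adj s t)
    (hs : IsLeaf T s) : side T s t = {s} := by
  ext v
  rw [mem_side_iff hT h, Set.mem_singleton_iff]
  refine or_iff_left ?_
  rintro ⟨u, hu, hne, -⟩
  exact hne (hs.eq_of_adj hu h.symm)

end Sides

/-! ### From tree decompositions to derivations -/

section TreeDecompositions

variable {A : Type*} [Fintype A] [DecidableEq A] {N : Type} {T : SimpleGraph N} {τ : N → Finset A}

open Classical in
/-- The union of the labels of the leaves on the side of `s` of the edge `st`. -/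
noncomputable def sideLabel (T : SimpleGraph N) (τ : N → Finset A) (s t : N) : Finset A :=
  {a | ∃ l, IsLeaf T l ∧ l ∈ side T s t ∧ a ∈ τ l}

omit [DecidableEq A] in
theorem mem_sideLabel {s t : N} {a : A} :
    a ∈ sideLabel T τ s t ↔ ∃ l, IsLeaf T l ∧ l ∈ side T s t ∧ a ∈ τ l := by
  simp [sideLabel]

omit [DecidableEq A] in
theorem componentLabel_eq_sideLabel (hT : T.IsTree) {s t : N} (h : T.Adj s t) :
    componentLabel T τ t ((T.induce {u | u ≠ t}).connectedComponentMk ⟨s, h.ne⟩) =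
      sideLabel T τ s t := by
  ext a
  rw [mem_sideLabel]
  simp only [componentLabel, Finset.mem_filter, Finset.mem_univ, true_and]
  constructor
  · rintro ⟨l, hl, hleaf, hc, ha⟩
    exact ⟨l, hleaf, (reachable_induce_iff hT h hl).1 (SimpleGraph.ConnectedComponent.eq.1 hc).symm,
      ha⟩
  · rintro ⟨l, hleaf, hl, ha⟩
    have hlt : l ≠ t := fun h' => right_notMem_side hT h (h' ▸ hl)
    exact ⟨l, hlt, hleaf,
      SimpleGraph.ConnectedComponent.eq.2 ((reachable_induce_iff hT h hlt).2 hl).symm, ha⟩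

omit [DecidableEq A] in
theorem mem_nodePartition (hT : T.IsTree) {t : N} {X : Finset A} :
    X ∈ nodePartition T τ t ↔ ∃ s, T.Adj s t ∧ X = sideLabel T τ s t := by
  simp only [nodePartition, Finset.mem_filter, Finset.mem_univ, true_and]
  constructor
  · rintro ⟨C, rfl⟩
    induction C using SimpleGraph.ConnectedComponent.ind with
    | h v =>
      obtain ⟨v, hv⟩ := v
      obtain ⟨s, hs, hvs⟩ := exists_mem_side hT hv
      refine ⟨s, hs, ?_⟩
      rw [← componentLabel_eq_sideLabel hT hs]
      congr 1
      exact SimpleGraph.ConnectedComponent.eq.2 ((reachable_induce_iff hT hs hv).2 hvs).symm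
  · rintro ⟨s, hs, rfl⟩
    exact ⟨_, (componentLabel_eq_sideLabel hT hs).symm⟩

omit [DecidableEq A] in
theorem sideLabel_of_isLeaf [Finite N] (hT : T.IsTree) {s t : N} (h : T.Adj s t)
    (hs : IsLeaf T s) : sideLabel T τ s t = τ s := by
  ext a
  rw [mem_sideLabel, side_eq_singleton hT h hs]
  constructor
  · rintro ⟨l, -, rfl, ha⟩
    exact ha
  · exact fun ha => ⟨s, hs, rfl, ha⟩

omit [DecidableEq A] in
theorem mem_sideLabel_iff (hT : T.IsTree) {s t : N} (h : T.Adj s t) (hs : ¬ IsLeaf T s) {a : A} :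
    a ∈ sideLabel T τ s t ↔ ∃ u, T.Adj u s ∧ u ≠ t ∧ a ∈ sideLabel T τ u s := by
  simp only [mem_sideLabel]
  constructor
  · rintro ⟨l, hl, hls, ha⟩
    rcases (mem_side_iff hT h l).1 hls with rfl | ⟨u, hu, hne, hlu⟩
    · exact absurd hl hs
    · exact ⟨u, hu, hne, l, hl, hlu, ha⟩
  · rintro ⟨u, hu, hne, l, hl, hlu, ha⟩
    exact ⟨l, hl, (mem_side_iff hT h l).2 (Or.inr ⟨u, hu, hne, hlu⟩), ha⟩

variable {Ps : Set (Finset (Finset A))} {Ss : Set (Finset A)}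

/-- The partition at `s` consists of the labels of the sides of its neighbours, and those away from
`t` make up the given side. Each of these sides has fewer nodes, which permits induction. -/
theorem winnable_sideLabel [Finite N] (hPs : ∀ P ∈ Ps, IsPartition P) (h0 : ∅ ∈ Ss)
    (hT : T.IsTree) (hl : ∀ l, IsLeaf T l → τ l ∈ Ss)
    (hP : ∀ t, ¬ IsLeaf T t → nodePartition T τ t ∈ Ps) {s t : N} (h : T.Adj s t) :
    Winnable Ps Ss (sideLabel T τ s t) := by
  induction hn : (side T s t).ncard using Nat.strong_induction_on generalizing s t with
  | _ n ih =>
  by_cases hs : IsLeaf T s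
  · rw [sideLabel_of_isLeaf hT h hs]
    exact .base (hl s hs)
  · have hpart := hPs _ (hP s hs)
    have hsat : Saturated (nodePartition T τ s) (sideLabel T τ s t) := by
      intro B hB
      by_cases hd : Disjoint B (sideLabel T τ s t)
      · exact Or.inr hd
      · obtain ⟨a, haB, ha⟩ := Finset.not_disjoint_iff.1 hd
        obtain ⟨u, hu, hne, hau⟩ := (mem_sideLabel_iff hT h hs).1 ha
        rw [hpart.eq_of_mem hB ((mem_nodePartition hT).2 ⟨u, hu, rfl⟩) haB hau]
        exact Or.inl fun b hb => (mem_sideLabel_iff hT h hs).2 ⟨u, hu, hne, hb⟩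
    refine .step _ (hP s hs) hsat fun B hB hBX => ?_
    -- An empty block may also come from the side of `t`, to which the induction does not apply.
    by_cases hne : B.Nonempty
    · obtain ⟨a, ha⟩ := hne
      obtain ⟨u, hu, hne, hau⟩ := (mem_sideLabel_iff hT h hs).1 (hBX ha)
      rw [hpart.eq_of_mem hB ((mem_nodePartition hT).2 ⟨u, hu, rfl⟩) ha hau]
      refine ih _ ?_ hu rfl
      rw [← hn]
      refine Set.ncard_lt_ncard ⟨fun v hv => (mem_side_iff hT h v).2 (Or.inr ⟨u, hu, hne, hv⟩),
        fun hsub => ?_⟩ (Set.toFinite _)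
      exact right_notMem_side hT hu (hsub (self_mem_side s t))
    · rw [Finset.not_nonempty_iff_eq_empty.1 hne]
      exact .base h0

theorem HasTreeDecomposition.winnable (hsc : IsScenario Ps Ss) (h0 : ∅ ∈ Ss)
    (h : HasTreeDecomposition Ps Ss) : Winnable Ps Ss Finset.univ := by
  obtain ⟨N, _, T, τ, hT, hl, hpart, hP⟩ := h
  by_cases hint : ∃ t, ¬ IsLeaf T t
  · obtain ⟨t, ht⟩ := hint
    refine .step _ (hP t ht) (saturated_univ _) fun B hB _ => ?_
    obtain ⟨s, hs, rfl⟩ := (mem_nodePartition hT).1 hB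
    exact winnable_sideLabel hsc.isPartition h0 hT hl hP hs
  -- Without internal nodes `T` is a single node or a single edge; the partition `{τ l, (τ l)ᶜ}`
  -- from the scenario axioms replaces the missing node partition.
  · push Not at hint
    obtain ⟨l⟩ := hT.connected.nonempty
    have hleaf : ∀ X ∈ leafLabels T τ, X ∈ Ss := by
      simp only [leafLabels, Finset.mem_filter, Finset.mem_univ, true_and]
      rintro _ ⟨l, h, rfl⟩
      exact hl l h
    have hsub : ∃ Y, ∀ X ∈ leafLabels T τ, X = τ l ∨ X = Y := by
      by_cases hadj : ∃ s, T.Adj s l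
      · obtain ⟨s, hs⟩ := hadj
        refine ⟨τ s, fun X hX => ?_⟩
        simp only [leafLabels, Finset.mem_filter, Finset.mem_univ, true_and] at hX
        obtain ⟨v, -, rfl⟩ := hX
        have h1 := mem_side_comm hT hs v
        rw [side_eq_singleton hT hs (hint s), side_eq_singleton hT hs.symm (hint l)] at h1
        by_cases hv : v = l
        · exact Or.inl (hv ▸ rfl)
        · by_cases hvs : v = s
          · exact Or.inr (hvs ▸ rfl)
          · exact absurd (h1.2 hvs) hv
      · refine ⟨τ l, fun X hX => ?_⟩
        simp only [leafLabels, Finset.mem_filter, Finset.mem_univ, true_and] at hX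
        obtain ⟨v, -, rfl⟩ := hX
        by_cases hv : v = l
        · exact Or.inl (hv ▸ rfl)
        · obtain ⟨u, hu, -⟩ := exists_mem_side hT hv
          exact absurd ⟨u, hu⟩ hadj
    obtain ⟨Y, hY⟩ := hsub
    have hmem : τ l ∈ leafLabels T τ := by
      simp only [leafLabels, Finset.mem_filter, Finset.mem_univ, true_and]
      exact ⟨l, hint l, rfl⟩
    have hpair := hsc.pair_mem _ (hl l (hint l))
    refine .step _ hpair (saturated_univ _) fun B hB _ => ?_
    rcases Finset.mem_insert.1 hB with rfl | hB
    · exact .base (hl l (hint l))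
    · rw [Finset.mem_singleton.1 hB]
      by_cases hne : (τ l)ᶜ.Nonempty
      · obtain ⟨a, ha⟩ := hne
        rw [Finset.mem_compl] at ha
        obtain ⟨B, hB, haB⟩ := hpart.exists_mem a
        have hBl : B ≠ τ l := fun h => ha (h ▸ haB)
        obtain rfl := (hY B hB).resolve_left hBl
        have : (τ l)ᶜ = B := by
          ext b
          rw [Finset.mem_compl]
          constructor
          · intro hb
            obtain ⟨C, hC, hbC⟩ := hpart.exists_mem b
            rcases hY C hC with rfl | rfl
            · exact absurd hbC hb
            · exact hbC
          · exact fun hb hb' => Finset.disjoint_left.1 (hpart.1 _ hB _ hmem hBl) hb hb'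
        rw [this]
        exact .base (hleaf B hB)
      · rw [Finset.not_nonempty_iff_eq_empty.1 hne]
        exact .base h0

end TreeDecompositions

/-! ### From branch decompositions to tree decompositions -/

section BranchToTree

variable {A : Type*} [Fintype A] [DecidableEq A] {N : Type} {T : SimpleGraph N} {L : A → N}

omit [DecidableEq A] in
theorem mem_edgeSide {s t : N} {a : A} : a ∈ edgeSide T L s t ↔ L a ∈ side T s t := by
  simp [edgeSide, side]

theorem edgeSide_comm (hT : T.IsTree) {s t : N} (h : T.Adj s t) :
    edgeSide T L t s = (edgeSide T L s t)ᶜ := by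
  ext a
  rw [mem_edgeSide, Finset.mem_compl, mem_edgeSide, mem_side_comm hT h]

omit [DecidableEq A] in
theorem edgeSide_of_isLeaf [Finite N] (hT : T.IsTree) (hL : Function.Injective L) {a : A} {t : N}
    (ha : IsLeaf T (L a)) (h : T.Adj (L a) t) : edgeSide T L (L a) t = {a} := by
  ext b
  rw [mem_edgeSide, side_eq_singleton hT h ha, Set.mem_singleton_iff, Finset.mem_singleton]
  exact ⟨fun h => hL h, fun h => h ▸ rfl⟩

theorem isPartition_edgeSides (hT : T.IsTree) {t : N} (ht : ∀ a, L a ≠ t) {Q : Finset (Finset A)}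
    (hQ : ∀ X, X ∈ Q ↔ ∃ s, T.Adj s t ∧ X = edgeSide T L s t) : IsPartition Q := by
  refine isPartition_of_existsUnique fun a => ?_
  obtain ⟨s, hs, has⟩ := exists_mem_side hT (ht a)
  refine ⟨_, (hQ _).2 ⟨s, hs, rfl⟩, mem_edgeSide.2 has, fun C hC haC => ?_⟩
  obtain ⟨u, hu, rfl⟩ := (hQ C).1 hC
  rw [eq_of_mem_side hT hs hu has (mem_edgeSide.1 haC)]

theorem hasTreeDecomposition_of_edgeSides [Finite N] {Ps : Set (Finset (Finset A))}
    (hT : T.IsTree) (hL : Set.BijOn L Set.univ {t | IsLeaf T t})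
    (hP : ∀ t, ¬ IsLeaf T t → ∀ Q : Finset (Finset A),
      (∀ X, X ∈ Q ↔ ∃ s, T.Adj s t ∧ X = edgeSide T L s t) → Q ∈ Ps) :
    HasTreeDecomposition Ps (sing A) := by
  classical
  have hinj : Function.Injective L := Set.injOn_univ.1 hL.injOn
  have hleaf : ∀ a, IsLeaf T (L a) := fun a => hL.mapsTo (Set.mem_univ a)
  let τ : N → Finset A := fun l => Finset.univ.filter fun a => L a = l
  have hτ : ∀ l a, a ∈ τ l ↔ L a = l := fun l a => by simp [τ]
  have hlabels : ∀ X, X ∈ leafLabels T τ ↔ ∃ l, IsLeaf T l ∧ τ l = X := fun X => by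
    simp [leafLabels]
  refine ⟨N, ‹_›, T, τ, hT, fun l hl => ?_, ?_, fun t ht => hP t ht _ fun X => ?_⟩
  · obtain ⟨a, -, rfl⟩ := hL.surjOn hl
    refine Or.inr ⟨a, ?_⟩
    ext b
    rw [hτ, Finset.mem_singleton]
    exact hinj.eq_iff
  · refine isPartition_of_existsUnique fun a => ?_
    refine ⟨τ (L a), (hlabels _).2 ⟨_, hleaf a, rfl⟩, (hτ _ _).2 rfl, fun C hC haC => ?_⟩
    obtain ⟨l, -, rfl⟩ := (hlabels C).1 hC
    rw [(hτ _ _).1 haC]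
  · rw [mem_nodePartition hT]
    have : ∀ s, sideLabel T τ s t = edgeSide T L s t := by
      intro s
      ext a
      rw [mem_sideLabel, mem_edgeSide]
      constructor
      · rintro ⟨l, -, hl, ha⟩
        rwa [(hτ _ _).1 ha]
      · exact fun h => ⟨L a, hleaf a, h, (hτ _ _).2 rfl⟩
    simp only [this]

variable {f : Finset A → ℕ} {w : ℕ}

theorem IsConnectivity.map_univ {f : Finset A → ℕ} (hf : IsConnectivity f) :
    f Finset.univ = 0 := by
  rw [← hf.map_compl, Finset.compl_univ, hf.map_empty]

/-- The singleton is one side of the edge at its leaf; if the leaf has no edge, then `{a}` is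
everything and has value `0`. -/
theorem HasBranchDecomposition.map_singleton_le (hf : IsConnectivity f)
    (h : HasBranchDecomposition f w) (a : A) : f {a} ≤ w := by
  obtain ⟨N, _, T, L, hT, -, hL, hw⟩ := h
  have hinj : Function.Injective L := Set.injOn_univ.1 hL.injOn
  by_cases hadj : ∃ t, T.Adj (L a) t
  · obtain ⟨t, ht⟩ := hadj
    rw [← edgeSide_of_isLeaf hT hinj (hL.mapsTo (Set.mem_univ a)) ht]
    exact hw _ _ ht
  · have : ({a} : Finset A) = Finset.univ := by
      rw [Finset.eq_univ_iff_forall]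
      intro b
      rw [Finset.mem_singleton]
      by_contra hb
      obtain ⟨u, hu, -⟩ := exists_mem_side hT (hinj.ne hb)
      exact hadj ⟨u, hu.symm⟩
    rw [this, hf.map_univ]
    exact Nat.zero_le _

theorem HasBranchDecomposition.hasTreeDecomposition (h : HasBranchDecomposition f w) :
    HasTreeDecomposition (part f (3 * w)) (sing A) := by
  classical
  obtain ⟨N, _, T, L, hT, hdeg, hL, hw⟩ := h
  refine hasTreeDecomposition_of_edgeSides hT hL fun t ht Q hQ => ?_
  have hne : ∀ a, L a ≠ t := fun a ha => ht (by rw [← ha]; exact hL.mapsTo (Set.mem_univ a))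
  refine ⟨isPartition_edgeSides hT hne hQ, ?_⟩
  have hfin : (T.neighborSet t).Finite := Set.toFinite _
  have hQ' : Q = hfin.toFinset.image fun s => edgeSide T L s t := by
    ext X
    rw [hQ, Finset.mem_image]
    constructor
    · rintro ⟨s, hs, rfl⟩
      exact ⟨s, hfin.mem_toFinset.2 hs.symm, rfl⟩
    · rintro ⟨s, hs, rfl⟩
      exact ⟨s, SimpleGraph.Adj.symm (hfin.mem_toFinset.1 hs), rfl⟩
  rw [hQ']
  -- Equal sides are counted once in `Q`, so its cost is at most the sum over the three edges.
  refine (sum_image_le f _ _).trans ?_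
  have := Finset.sum_le_card_nsmul hfin.toFinset (fun s => f (edgeSide T L s t)) w
    fun s hs => hw _ _ (SimpleGraph.Adj.symm (hfin.mem_toFinset.1 hs))
  rwa [← Set.ncard_eq_toFinset_card _ hfin, hdeg t ht, smul_eq_mul] at this

end BranchToTree

/-! ### Derivations refined to bisections -/

section BinarySplitting

variable {A : Type*} [Fintype A] [DecidableEq A]

/-- `X` can be split into singletons by repeated bisection, where the two halves of a set and the
complement of that set always form a partition in `Ps`. -/
inductive Splittable (Ps : Set (Finset (Finset A))) : Finset A → Prop
  | single (a : A) : Splittable Ps {a}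
  | join {X Y : Finset A} (hX : Splittable Ps X) (hY : Splittable Ps Y) (h : Disjoint X Y)
      (hP : {X, Y, (X ∪ Y)ᶜ} ∈ Ps) : Splittable Ps (X ∪ Y)

theorem Splittable.nonempty {Ps : Set (Finset (Finset A))} {X : Finset A} (h : Splittable Ps X) :
    X.Nonempty := by
  induction h with
  | single a => exact Finset.singleton_nonempty a
  | join _ _ _ _ ih _ => exact ih.mono Finset.subset_union_left

variable {f : Finset A → ℕ} {k : ℕ}

/-- The blocks of `P` inside `X` are joined one at a time. Every intermediate triple is coarser than
`P` and therefore allowed. -/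
theorem Winnable.splittable (hf : IsConnectivity f) {X : Finset A} (hX : X.Nonempty)
    (h : Winnable (part f k) (sing A) X) : Splittable (part f k) X := by
  induction h with
  | base h =>
    rcases h with rfl | ⟨a, rfl⟩
    · exact absurd rfl hX.ne_empty
    · exact .single a
  | @step X P hP hs hw ih =>
    have key : ∀ R : Finset (Finset A), R ⊆ P → (∀ B ∈ R, B.Nonempty ∧ B ⊆ X) → R.Nonempty →
        Splittable (part f k) (R.sup id) := by
      intro R
      induction R using Finset.induction_on with
      | empty => exact fun _ _ h => absurd rfl h.ne_empty
      | insert B R hB ihR =>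
        intro hRP hRX _
        obtain ⟨hBP, hRP⟩ := Finset.insert_subset_iff.1 hRP
        have hBX := hRX B (Finset.mem_insert_self _ _)
        have hsB := ih B hBP hBX.2 hBX.1
        rw [Finset.sup_insert]
        by_cases hR : R.Nonempty
        · have hsR := ihR hRP (fun C hC => hRX C (Finset.mem_insert_of_mem hC)) hR
          have hd : Disjoint B (R.sup id) := by
            rw [Finset.disjoint_sup_right]
            exact fun C hC => hP.1.1 B hBP C (hRP hC) fun h => hB (h ▸ hC)
          refine .join hsB hsR hd (part_of_saturated hf hP (IsPartition.triple hd) ?_)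
          intro Z hZ _
          simp only [Finset.mem_insert, Finset.mem_singleton] at hZ
          rcases hZ with rfl | rfl | rfl
          · exact hP.1.saturated_of_mem hBP
          · exact hP.1.saturated_sup hRP
          · have := hP.1.saturated_sup (Finset.insert_subset hBP hRP)
            rw [Finset.sup_insert] at this
            exact this.compl
        · rw [Finset.not_nonempty_iff_eq_empty.1 hR]
          simpa using hsB
    have hsup : (P.filter (fun B => B.Nonempty ∧ B ⊆ X)).sup id = X := by
      ext a
      simp only [Finset.mem_sup, Finset.mem_filter, id]
      constructor
      · rintro ⟨B, ⟨-, -, hBX⟩, ha⟩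
        exact hBX ha
      · intro ha
        obtain ⟨B, hB, haB⟩ := hP.1.exists_mem a
        refine ⟨B, ⟨hB, ⟨a, haB⟩, ?_⟩, haB⟩
        exact (hs B hB).resolve_right fun hd => Finset.disjoint_left.1 hd haB ha
    have := key (P.filter (fun B => B.Nonempty ∧ B ⊆ X)) (Finset.filter_subset _ _)
      (fun B hB => (Finset.mem_filter.1 hB).2) ?_
    · rwa [hsup] at this
    · rw [Finset.nonempty_iff_ne_empty]
      intro h0
      rw [h0, Finset.sup_empty] at hsup
      exact hX.ne_empty hsup.symm

theorem Winnable.exists_mem {Ps : Set (Finset (Finset A))} (hPs : ∀ P ∈ Ps, IsPartition P)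
    {Ls : Set (Finset A)} {X : Finset A} (h : Winnable Ps Ls X) {a : A} (ha : a ∈ X) :
    ∃ Y ∈ Ls, a ∈ Y := by
  induction h with
  | base h => exact ⟨_, h, ha⟩
  | step P hP hs _ ih =>
    obtain ⟨B, hB, haB⟩ := (hPs P hP).exists_mem a
    exact ih B hB ((hs B hB).resolve_right fun hd => Finset.disjoint_left.1 hd haB ha) haB

/-- Re-root at the leaf `{a}`, with `{a}` removed from the other targets. The alternative, a win
without `{a}`, is impossible because no remaining target contains `a`. -/
theorem Winnable.compl_singleton (hf : IsConnectivity f)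
    (h : Winnable (part f k) (sing A) Finset.univ) (a : A) :
    Winnable (part f k) (sing A) {a}ᶜ := by
  have hins : insert {a} (sing A \ {{a}}) = sing A := by
    rw [Set.insert_sdiff_singleton]
    exact Set.insert_eq_of_mem (Or.inr ⟨a, rfl⟩)
  rw [← hins] at h
  have h0 : Winnable (part f k) (sing A \ {{a}}) Finset.univᶜ := by
    rw [Finset.compl_univ]
    exact .base ⟨Or.inl rfl, (Finset.singleton_ne_empty a).symm⟩
  rcases h.reroot hf (Finset.singleton_nonempty a) h0 (by rw [hf.map_univ]; omega) with h | h
  · obtain ⟨Y, ⟨hY, hYa⟩, haY⟩ := h.exists_mem (fun P hP => hP.1) (Finset.mem_univ a)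
    rcases hY with rfl | ⟨b, rfl⟩
    · simp at haY
    · rw [Finset.mem_singleton] at haY
      exact absurd (by rw [haY]; rfl) hYa
  · exact h.1.mono Set.sdiff_subset

end BinarySplitting

/-! ### Labelled binary trees -/

section Labellings

variable {A : Type*} [Fintype A] [DecidableEq A]

/-- A labelling of the nodes of the infinite binary tree by subsets of `A`, almost all of them
empty, such that the labels of the two children of a node are disjoint subsets of its label. -/
structure IsLaminar (lab : List Bool → Finset A) : Prop where
  finite : {q | (lab q).Nonempty}.Finite
  subset : ∀ q b, lab (q ++ [b]) ⊆ lab q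
  disjoint : ∀ q, Disjoint (lab (q ++ [false])) (lab (q ++ [true]))

/-- The children of the node `q` have empty labels, and its own label is a singleton. -/
def IsEnd (lab : List Bool → Finset A) (q : List Bool) : Prop :=
  (∃ a, lab q = {a}) ∧ ∀ b, lab (q ++ [b]) = ∅

/-- The labels of the children of `q` are not empty, have union `lab q`, and form a partition in
`Ps` together with the complement of `lab q`. -/
def IsBranching (Ps : Set (Finset (Finset A))) (lab : List Bool → Finset A) (q : List Bool) :
    Prop :=
  (∀ b, (lab (q ++ [b])).Nonempty) ∧ lab q = lab (q ++ [false]) ∪ lab (q ++ [true]) ∧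
    {lab (q ++ [false]), lab (q ++ [true]), (lab q)ᶜ} ∈ Ps

/-- The labelling with label `Z` at the root and the given labellings below it. -/
def glue (Z : Finset A) (l₀ l₁ : List Bool → Finset A) : List Bool → Finset A
  | [] => Z
  | false :: q => l₀ q
  | true :: q => l₁ q

omit [Fintype A] [DecidableEq A] in
theorem IsLaminar.glue {Z : Finset A} {l₀ l₁ : List Bool → Finset A} (h₀ : IsLaminar l₀)
    (h₁ : IsLaminar l₁) (hs₀ : l₀ [] ⊆ Z) (hs₁ : l₁ [] ⊆ Z) (hd : Disjoint (l₀ []) (l₁ [])) :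
    IsLaminar (glue Z l₀ l₁) where
  finite := by
    refine (((h₀.finite.image (List.cons false)).union (h₁.finite.image (List.cons true))).union
      (Set.finite_singleton [])).subset ?_
    rintro (_ | ⟨_ | _, q⟩) hq
    · exact Or.inr rfl
    · exact Or.inl (Or.inl ⟨q, hq, rfl⟩)
    · exact Or.inl (Or.inr ⟨q, hq, rfl⟩)
  subset := by
    rintro (_ | ⟨_ | _, q⟩) b
    · cases b
      · exact hs₀
      · exact hs₁
    · exact h₀.subset q b
    · exact h₁.subset q b
  disjoint := by
    rintro (_ | ⟨_ | _, q⟩)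
    · exact hd
    · exact h₀.disjoint q
    · exact h₁.disjoint q

omit [Fintype A] [DecidableEq A] in
theorem isLaminar_empty : IsLaminar fun _ => (∅ : Finset A) where
  finite := by simp
  subset _ _ := subset_rfl
  disjoint _ := Finset.disjoint_empty_left _

theorem Splittable.exists_labelling {Ps : Set (Finset (Finset A))} {X : Finset A}
    (h : Splittable Ps X) : ∃ lab, IsLaminar lab ∧ lab [] = X ∧
      ∀ q, (lab q).Nonempty → IsEnd lab q ∨ IsBranching Ps lab q := by
  induction h with
  | single a =>
    refine ⟨glue {a} (fun _ => ∅) (fun _ => ∅), isLaminar_empty.glue isLaminar_empty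
      (Finset.empty_subset _) (Finset.empty_subset _) (Finset.disjoint_empty_left _), rfl, ?_⟩
    rintro (_ | ⟨_ | _, q⟩) hq
    · refine Or.inl ⟨⟨a, rfl⟩, fun b => ?_⟩
      cases b <;> rfl
    · exact absurd rfl hq.ne_empty
    · exact absurd rfl hq.ne_empty
  | @join X Y hX hY hd hP ihX ihY =>
    obtain ⟨l₀, h₀, rfl, hn₀⟩ := ihX
    obtain ⟨l₁, h₁, rfl, hn₁⟩ := ihY
    refine ⟨glue (l₀ [] ∪ l₁ []) l₀ l₁, h₀.glue h₁ Finset.subset_union_left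
      Finset.subset_union_right hd, rfl, ?_⟩
    rintro (_ | ⟨_ | _, q⟩) hq
    · refine Or.inr ⟨fun b => ?_, rfl, hP⟩
      cases b
      · exact hX.nonempty
      · exact hY.nonempty
    · exact hn₀ q hq
    · exact hn₁ q hq

end Labellings

/-! ### Cubic trees from labellings -/

section PositionTree

variable {A : Type*} {lab : List Bool → Finset A}

/-- The nodes with nonempty label. -/
abbrev Pos (lab : List Bool → Finset A) : Type := {q : List Bool // (lab q).Nonempty}

/-- The infinite binary tree, restricted to the nodes with nonempty label. -/
def posGraph (lab : List Bool → Finset A) : SimpleGraph (Pos lab) where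
  Adj p q := (∃ b, q.1 = p.1 ++ [b]) ∨ ∃ b, p.1 = q.1 ++ [b]
  symm := ⟨fun _ _ h => h.symm⟩
  loopless := ⟨by rintro p (⟨b, h⟩ | ⟨b, h⟩) <;> simpa using congrArg List.length h⟩

theorem IsLaminar.finite_pos (h : IsLaminar lab) : Finite (Pos lab) :=
  h.finite.to_subtype

/-- The edge `qp` is the only one that leaves the set of descendants of `q`, which is therefore the
side of `q`. -/
theorem prefix_of_adj {p q v w : Pos lab} {b : Bool} (hq : q.1 = p.1 ++ [b])
    (h : (posGraph lab).Adj v w) (hne : s(v, w) ≠ s(q, p)) (hv : q.1 <+: v.1) :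
    q.1 <+: w.1 := by
  rcases h with ⟨c, hc⟩ | ⟨c, hc⟩
  · rw [hc]
    exact hv.trans (List.prefix_append _ _)
  · rw [hc, List.prefix_concat_iff] at hv
    refine hv.resolve_left fun he => hne ?_
    have h1 : v = q := Subtype.ext (hc.trans he.symm)
    have h2 : w = p := Subtype.ext (List.append_inj' (he.symm.trans hq) rfl).1
    rw [h1, h2]

theorem not_prefix_of_eq_append {p q : Pos lab} {b : Bool} (hq : q.1 = p.1 ++ [b]) :
    ¬ q.1 <+: p.1 := by
  intro h
  have := h.length_le
  rw [hq, List.length_append, List.length_singleton] at this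
  omega

theorem prefix_of_mem_side {p q u : Pos lab} {b : Bool} (hq : q.1 = p.1 ++ [b])
    (hu : u ∈ side (posGraph lab) q p) : q.1 <+: u.1 :=
  mem_side_induction (S := {u : Pos lab | q.1 <+: u.1}) hu List.prefix_rfl
    fun _ _ hvw hne _ hv => prefix_of_adj hq hvw hne hv

theorem not_prefix_of_mem_side {p q u : Pos lab} {b : Bool} (hq : q.1 = p.1 ++ [b])
    (hu : u ∈ side (posGraph lab) p q) : ¬ q.1 <+: u.1 :=
  mem_side_induction (S := {u : Pos lab | ¬ q.1 <+: u.1}) hu (not_prefix_of_eq_append hq)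
    fun _ _ hvw hne _ hv hw => hv (prefix_of_adj hq hvw.symm
      (by rwa [Sym2.eq_swap, Sym2.eq_swap (a := q)]) hw)

theorem IsLaminar.isTree (h : IsLaminar lab) (h0 : (lab []).Nonempty) :
    (posGraph lab).IsTree where
  connected := by
    have key : ∀ l (hl : (lab l).Nonempty), (posGraph lab).Reachable ⟨[], h0⟩ ⟨l, hl⟩ := by
      intro l
      induction l using List.reverseRecOn with
      | nil => exact fun _ => SimpleGraph.Reachable.refl _
      | append_singleton l b ih =>
        intro hl
        refine (ih (hl.mono (h.subset l b))).trans (SimpleGraph.Adj.reachable ?_)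
        exact Or.inl ⟨b, rfl⟩
    have : Nonempty (Pos lab) := ⟨⟨[], h0⟩⟩
    exact ⟨fun u v => (key u.1 u.2).symm.trans (key v.1 v.2)⟩
  isAcyclic := by
    rw [SimpleGraph.isAcyclic_iff_forall_adj_isBridge]
    rintro v w (⟨b, hb⟩ | ⟨b, hb⟩)
    · rw [SimpleGraph.isBridge_iff]
      exact fun hr => not_prefix_of_mem_side hb hr List.prefix_rfl
    · rw [SimpleGraph.isBridge_iff]
      exact fun hr => not_prefix_of_eq_append hb (prefix_of_mem_side hb hr)

theorem IsLaminar.mem_side_iff (h : IsLaminar lab) (h0 : (lab []).Nonempty) {p q : Pos lab}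
    {b : Bool} (hq : q.1 = p.1 ++ [b]) (u : Pos lab) :
    u ∈ side (posGraph lab) q p ↔ q.1 <+: u.1 := by
  refine ⟨prefix_of_mem_side hq, fun hu => ?_⟩
  rw [mem_side_comm (h.isTree h0) (Or.inl ⟨b, hq⟩)]
  exact fun h' => not_prefix_of_mem_side hq h' hu

theorem IsLaminar.subset_of_prefix (h : IsLaminar lab) {p q : List Bool} (hpq : p <+: q) :
    lab q ⊆ lab p := by
  obtain ⟨r, rfl⟩ := hpq
  induction r using List.reverseRecOn with
  | nil => rw [List.append_nil]
  | append_singleton r b ih =>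
    rw [← List.append_assoc]
    exact (h.subset _ _).trans ih

/-- Where two paths diverge, the labels are disjoint. -/
theorem IsLaminar.prefix_or_prefix (h : IsLaminar lab) {p q : List Bool} {a : A}
    (hp : a ∈ lab p) (hq : a ∈ lab q) : p <+: q ∨ q <+: p := by
  induction p using List.reverseRecOn with
  | nil => exact Or.inl List.nil_prefix
  | append_singleton p b ih =>
    rcases ih (h.subset p b hp) with ⟨_ | ⟨c, r⟩, rfl⟩ | hqp
    · rw [List.append_nil]
      exact Or.inr (List.prefix_append _ _)
    · rw [List.append_cons p c r] at hq ⊢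
      have hc := h.subset_of_prefix (List.prefix_append _ _) hq
      have hbc : b = c := by
        have hd := Finset.disjoint_left.1 (h.disjoint p)
        cases b <;> cases c
        · rfl
        · exact absurd hc (hd hp)
        · exact absurd hp (hd hc)
        · rfl
      rw [hbc]
      exact Or.inl (List.prefix_append _ _)
    · exact Or.inr (hqp.trans (List.prefix_append _ _))

theorem IsEnd.eq_of_prefix (h : IsLaminar lab) {p q : List Bool} (hp : IsEnd lab p)
    (hq : (lab q).Nonempty) (hpq : p <+: q) : q = p := by
  obtain ⟨_ | ⟨c, r⟩, rfl⟩ := hpq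
  · exact List.append_nil p
  · rw [List.append_cons] at hq
    have := hq.mono (h.subset_of_prefix (List.prefix_append _ _))
    rw [hp.2 c] at this
    exact absurd rfl this.ne_empty

theorem IsEnd.eq_of_mem (h : IsLaminar lab) {p q : List Bool} {a : A} (hp : IsEnd lab p)
    (hq : IsEnd lab q) (hap : a ∈ lab p) (haq : a ∈ lab q) : p = q := by
  rcases h.prefix_or_prefix hap haq with hpq | hqp
  · exact (hp.eq_of_prefix h ⟨a, haq⟩ hpq).symm
  · exact hq.eq_of_prefix h ⟨a, hap⟩ hqp

variable [Fintype A] [DecidableEq A] {Ps : Set (Finset (Finset A))}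

/-- A labelling that describes a cubic tree whose root is the leaf of `r` and whose other leaves are
the ends of the labelling. -/
structure IsRooted (Ps : Set (Finset (Finset A))) (lab : List Bool → Finset A) (r : A) : Prop
    extends IsLaminar lab where
  root : lab [] = Finset.univ
  left : lab [false] = ∅
  right : lab [true] = {r}ᶜ
  node : ∀ q, q ≠ [] → (lab q).Nonempty → IsEnd lab q ∨ IsBranching Ps lab q

/-- The root is given a single nonempty child, so that it has degree one and can serve as the leaf
of `r`. -/
theorem Splittable.exists_isRooted {r : A} (h : Splittable Ps {r}ᶜ) :
    ∃ lab, IsRooted Ps lab r := by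
  obtain ⟨l, hl, hr, hn⟩ := h.exists_labelling
  refine ⟨CaptainRobber.glue Finset.univ (fun _ => ∅) l,
    isLaminar_empty.glue hl (Finset.empty_subset _) (Finset.subset_univ _)
      (Finset.disjoint_empty_left _), rfl, rfl, hr, ?_⟩
  rintro (_ | ⟨_ | _, q⟩) hne hq
  · exact absurd rfl hne
  · exact absurd rfl hq.ne_empty
  · exact hn q hq

variable {r : A}

theorem IsRooted.exists_isEnd (h : IsRooted Ps lab r) {q : List Bool} (hq : q ≠ []) {a : A}
    (ha : a ∈ lab q) : ∃ p, q <+: p ∧ IsEnd lab p ∧ lab p = {a} := by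
  induction hn : (lab q).card using Nat.strong_induction_on generalizing q with
  | _ n ih =>
  rcases h.node q hq ⟨a, ha⟩ with hend | hbr
  · refine ⟨q, List.prefix_rfl, hend, ?_⟩
    obtain ⟨b, hb⟩ := hend.1
    rw [hb, Finset.mem_singleton] at ha
    rw [hb, ha]
  · have hcard := Finset.card_union_of_disjoint (h.disjoint q)
    rw [← hbr.2.1] at hcard
    have hpos := fun b => Finset.card_pos.2 (hbr.1 b)
    have h1 := hpos false
    have h2 := hpos true
    have : ∃ b, a ∈ lab (q ++ [b]) := by
      rw [hbr.2.1, Finset.mem_union] at ha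
      exact ha.elim (fun h => ⟨_, h⟩) fun h => ⟨_, h⟩
    obtain ⟨b, hb⟩ := this
    obtain ⟨p, hqp, hp⟩ := ih (lab (q ++ [b])).card (by cases b <;> omega)
      (List.append_ne_nil_of_right_ne_nil _ (List.cons_ne_nil _ _)) hb rfl
    exact ⟨p, (List.prefix_append _ _).trans hqp, hp⟩

theorem IsRooted.exists_leafMap (h : IsRooted Ps lab r) : ∃ L : A → Pos lab,
    (L r).1 = [] ∧ (∀ a, a ≠ r → [true] <+: (L a).1 ∧ IsEnd lab (L a).1 ∧ lab (L a).1 = {a}) := by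
  have hex : ∀ a, ∃ p : Pos lab, (a = r → p.1 = []) ∧
      (a ≠ r → [true] <+: p.1 ∧ IsEnd lab p.1 ∧ lab p.1 = {a}) := by
    intro a
    by_cases ha : a = r
    · exact ⟨⟨[], by rw [h.root]; exact ⟨a, Finset.mem_univ a⟩⟩, fun _ => rfl,
        fun h => absurd ha h⟩
    · obtain ⟨p, hp⟩ := h.exists_isEnd (q := [true]) (List.cons_ne_nil _ _) (a := a)
        (by rw [h.right]; simpa using ha)
      exact ⟨⟨p, by rw [hp.2.2]; exact Finset.singleton_nonempty a⟩, fun h => absurd h ha,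
        fun _ => hp⟩
  choose L hL using hex
  exact ⟨L, (hL r).1 rfl, fun a => (hL a).2⟩

variable {L : A → Pos lab}

theorem IsRooted.prefix_leafMap_iff (h : IsRooted Ps lab r) (hr : (L r).1 = [])
    (hL : ∀ a, a ≠ r → [true] <+: (L a).1 ∧ IsEnd lab (L a).1 ∧ lab (L a).1 = {a})
    {q : List Bool} (hq : q ≠ []) (a : A) : q <+: (L a).1 ↔ a ∈ lab q := by
  by_cases ha : a = r
  · subst ha
    rw [hr, List.prefix_nil]
    refine iff_of_false hq fun haq => ?_
    obtain ⟨_ | _, q, rfl⟩ := List.exists_cons_of_ne_nil hq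
    · have := h.subset_of_prefix (p := [false]) (by simp) haq
      simp [h.left] at this
    · have := h.subset_of_prefix (p := [true]) (by simp) haq
      simp [h.right] at this
  · obtain ⟨-, hend, hlab⟩ := hL a ha
    constructor
    · intro hp
      exact h.subset_of_prefix hp (by simp [hlab])
    · intro haq
      obtain ⟨p, hqp, hp, hlabp⟩ := h.exists_isEnd hq haq
      rwa [hend.eq_of_mem h.toIsLaminar hp (a := a) (by simp [hlab]) (by simp [hlabp])]

theorem IsRooted.root_nonempty (h : IsRooted Ps lab r) : (lab []).Nonempty := by
  rw [h.root]
  exact ⟨r, Finset.mem_univ r⟩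

theorem IsRooted.edgeSide_eq (h : IsRooted Ps lab r) (hr : (L r).1 = [])
    (hL : ∀ a, a ≠ r → [true] <+: (L a).1 ∧ IsEnd lab (L a).1 ∧ lab (L a).1 = {a})
    {p q : Pos lab} {b : Bool} (hq : q.1 = p.1 ++ [b]) :
    edgeSide (posGraph lab) L q p = lab q.1 := by
  ext a
  rw [mem_edgeSide, h.mem_side_iff h.root_nonempty hq, h.prefix_leafMap_iff hr hL]
  simp [hq]

theorem IsRooted.isLeaf_of_eq_nil (h : IsRooted Ps lab r) {q : Pos lab} (hq : q.1 = []) :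
    IsLeaf (posGraph lab) q := by
  have := h.finite_pos
  refine (Set.ncard_le_one (Set.toFinite _)).2 ?_
  have key : ∀ p ∈ (posGraph lab).neighborSet q, p.1 = [true] := by
    rintro p (⟨b, hb⟩ | ⟨b, hb⟩)
    · rw [hq, List.nil_append] at hb
      cases b
      · exact absurd (by rw [hb, h.left]) p.2.ne_empty
      · exact hb
    · simp [hq] at hb
  exact fun p hp p' hp' => Subtype.ext ((key p hp).trans (key p' hp').symm)

omit [Fintype A] [DecidableEq A] in
theorem IsEnd.isLeaf (h : IsLaminar lab) {q : Pos lab} (hq : IsEnd lab q.1) :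
    IsLeaf (posGraph lab) q := by
  have := h.finite_pos
  refine (Set.ncard_le_one (Set.toFinite _)).2 ?_
  have key : ∀ p ∈ (posGraph lab).neighborSet q, p.1 = q.1.dropLast := by
    rintro p (⟨b, hb⟩ | ⟨b, hb⟩)
    · exact absurd (by rw [hb, hq.2 b]) p.2.ne_empty
    · rw [hb, List.dropLast_concat]
  exact fun p hp p' hp' => Subtype.ext ((key p hp).trans (key p' hp').symm)

theorem IsBranching.adj_iff {q : List Bool} (hq : (lab q).Nonempty) {b : Bool}
    (hb : IsBranching Ps lab (q ++ [b])) (hb' : (lab (q ++ [b])).Nonempty) (p : Pos lab) :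
    (posGraph lab).Adj ⟨q ++ [b], hb'⟩ p ↔
      p = ⟨q, hq⟩ ∨ p = ⟨q ++ [b] ++ [false], hb.1 false⟩ ∨
        p = ⟨q ++ [b] ++ [true], hb.1 true⟩ := by
  constructor
  · rintro (⟨c, hc⟩ | ⟨c, hc⟩)
    · cases c
      · exact Or.inr (Or.inl (Subtype.ext hc))
      · exact Or.inr (Or.inr (Subtype.ext hc))
    · exact Or.inl (Subtype.ext (List.append_inj' hc rfl).1.symm)
  · rintro (rfl | rfl | rfl)
    · exact Or.inr ⟨b, rfl⟩
    · exact Or.inl ⟨false, rfl⟩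
    · exact Or.inl ⟨true, rfl⟩

theorem IsBranching.ncard_neighborSet {q : List Bool} (hq : (lab q).Nonempty) {b : Bool}
    (hb : IsBranching Ps lab (q ++ [b])) (hb' : (lab (q ++ [b])).Nonempty) :
    ((posGraph lab).neighborSet ⟨q ++ [b], hb'⟩).ncard = 3 := by
  rw [Set.ncard_eq_three]
  refine ⟨⟨q, hq⟩, ⟨q ++ [b] ++ [false], hb.1 false⟩, ⟨q ++ [b] ++ [true], hb.1 true⟩,
    ?_, ?_, ?_, ?_⟩
  · simp
  · simp
  · simp
  · ext p
    rw [SimpleGraph.mem_neighborSet, hb.adj_iff hq hb']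
    rfl

theorem IsRooted.eq_concat_of_not_isLeaf (h : IsRooted Ps lab r) {q : Pos lab}
    (hq : ¬ IsLeaf (posGraph lab) q) : ∃ p b, q.1 = p ++ [b] ∧ (lab p).Nonempty ∧
      IsBranching Ps lab (p ++ [b]) := by
  rcases List.eq_nil_or_concat' q.1 with h0 | ⟨p, b, hpb⟩
  · exact absurd (h.isLeaf_of_eq_nil h0) hq
  · refine ⟨p, b, hpb, (hpb ▸ q.2).mono (h.subset p b), ?_⟩
    rw [← hpb]
    exact (h.node q.1 (by simp [hpb]) q.2).resolve_left fun he => hq (he.isLeaf h.toIsLaminar)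

theorem IsRooted.bijOn_leafMap (h : IsRooted Ps lab r) (hr : (L r).1 = [])
    (hL : ∀ a, a ≠ r → [true] <+: (L a).1 ∧ IsEnd lab (L a).1 ∧ lab (L a).1 = {a}) :
    Set.BijOn L Set.univ {t | IsLeaf (posGraph lab) t} := by
  have hne : ∀ a, a ≠ r → (L a).1 ≠ [] := fun a ha h0 => by
    have := (hL a ha).1
    rw [h0] at this
    simp at this
  refine ⟨fun a _ => ?_, fun a _ a' _ haa' => ?_, fun q hq => ?_⟩
  · by_cases ha : a = r
    · exact ha ▸ h.isLeaf_of_eq_nil hr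
    · exact (hL a ha).2.1.isLeaf h.toIsLaminar
  · by_cases ha : a = r
    · by_cases ha' : a' = r
      · rw [ha, ha']
      · exact absurd (by rw [← haa', ha, hr]) (hne a' ha')
    · by_cases ha' : a' = r
      · exact absurd (by rw [haa', ha', hr]) (hne a ha)
      · have h1 := (hL a ha).2.2
        rw [haa', (hL a' ha').2.2] at h1
        exact (Finset.singleton_injective h1).symm
  · rcases List.eq_nil_or_concat' q.1 with h0 | ⟨p, b, hpb⟩
    · exact ⟨r, Set.mem_univ r, Subtype.ext (hr.trans h0.symm)⟩
    · rcases h.node q.1 (by simp [hpb]) q.2 with he | hb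
      · obtain ⟨a, ha⟩ := he.1
        have haq : a ∈ lab q.1 := by simp [ha]
        have hp := (h.prefix_leafMap_iff hr hL (by simp [hpb]) a).2 haq
        refine ⟨a, Set.mem_univ a, Subtype.ext ?_⟩
        exact he.eq_of_prefix h.toIsLaminar (L a).2 hp
      · obtain ⟨q, hq'⟩ := q
        simp only at hpb
        subst hpb
        have h1 : _ ≤ 1 := hq
        rw [hb.ncard_neighborSet (hq'.mono (h.subset p b))] at h1
        omega

theorem IsRooted.hasTreeDecomposition (h : IsRooted Ps lab r) :
    HasTreeDecomposition Ps (sing A) := by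
  have := h.finite_pos
  obtain ⟨L, hr, hL⟩ := h.exists_leafMap
  have hT := h.isTree h.root_nonempty
  refine hasTreeDecomposition_of_edgeSides hT (h.bijOn_leafMap hr hL) fun t ht Q hQ => ?_
  obtain ⟨p, b, hpb, hp, hb⟩ := h.eq_concat_of_not_isLeaf ht
  obtain ⟨t, ht'⟩ := t
  simp only at hpb
  subst hpb
  convert hb.2.2
  ext X
  have h0 : edgeSide (posGraph lab) L ⟨p, hp⟩ ⟨p ++ [b], ht'⟩ = (lab (p ++ [b]))ᶜ := by
    rw [edgeSide_comm hT (Or.inr ⟨b, rfl⟩), h.edgeSide_eq hr hL (b := b) rfl]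
  have h1 : ∀ c, edgeSide (posGraph lab) L ⟨p ++ [b] ++ [c], hb.1 c⟩ ⟨p ++ [b], ht'⟩ =
      lab (p ++ [b] ++ [c]) := fun c => h.edgeSide_eq hr hL (b := c) rfl
  simp only [hQ, Finset.mem_insert, Finset.mem_singleton]
  constructor
  · rintro ⟨s, hs, rfl⟩
    rcases (hb.adj_iff hp ht' s).1 hs.symm with rfl | rfl | rfl
    · exact Or.inr (Or.inr h0)
    · exact Or.inl (h1 false)
    · exact Or.inr (Or.inl (h1 true))
  · rintro (rfl | rfl | rfl)
    · exact ⟨_, Or.inr ⟨false, rfl⟩, (h1 false).symm⟩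
    · exact ⟨_, Or.inr ⟨true, rfl⟩, (h1 true).symm⟩
    · exact ⟨_, Or.inl ⟨b, rfl⟩, h0.symm⟩

variable {f : Finset A → ℕ} {k : ℕ}

theorem IsRooted.hasBranchDecomposition (hf : IsConnectivity f) (hk : ∀ a, 2 * f {a} ≤ k)
    (h : IsRooted (part f k) lab r) : HasBranchDecomposition f k := by
  have := h.finite_pos
  obtain ⟨L, hr, hL⟩ := h.exists_leafMap
  have hT := h.isTree h.root_nonempty
  refine ⟨Pos lab, this, posGraph lab, L, hT, fun t ht => ?_, h.bijOn_leafMap hr hL, ?_⟩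
  · obtain ⟨p, b, hpb, hp, hb⟩ := h.eq_concat_of_not_isLeaf ht
    obtain ⟨t, ht'⟩ := t
    simp only at hpb
    subst hpb
    exact hb.ncard_neighborSet hp ht'
  -- Every edge joins a node to its parent and separates off the label of the lower node. That label
  -- is a singleton or the complement of a block of an allowed partition.
  · have key : ∀ (p q : Pos lab) (b : Bool), q.1 = p.1 ++ [b] → f (lab q.1) ≤ k := by
      intro p q b hq
      rcases h.node q.1 (by simp [hq]) q.2 with ⟨⟨a, ha⟩, -⟩ | hb
      · have := hk a
        rw [ha]
        omega
      · have h1 := hb.2.2.1.saturated_of_mem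
          (X := (lab q.1)ᶜ) (by simp)
        have := two_mul_le_of_saturated hf hb.2.2 h1
        rw [hf.map_compl] at this
        omega
    rintro s t (⟨b, hb⟩ | ⟨b, hb⟩)
    · rw [edgeSide_comm hT (Or.inr ⟨b, hb⟩), hf.map_compl, h.edgeSide_eq hr hL hb]
      exact key s t b hb
    · rw [h.edgeSide_eq hr hL hb]
      exact key t s b hb

end PositionTree

/-! ### The equivalences and the factor of three -/

section Characterization

variable {A : Type*} [Fintype A] [DecidableEq A] {f : Finset A → ℕ} {k : ℕ}

/-- The one-node tree has neither internal nodes nor edges, so `Ps` and `k` can be arbitrary. -/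
theorem decompositions_of_subsingleton [Nonempty A] [Subsingleton A]
    (Ps : Set (Finset (Finset A))) (f : Finset A → ℕ) (k : ℕ) :
    HasTreeDecomposition Ps (sing A) ∧ HasBranchDecomposition f k := by
  have hT : (⊥ : SimpleGraph Unit).IsTree := SimpleGraph.IsTree.of_subsingleton
  have hleaf : ∀ t, IsLeaf (⊥ : SimpleGraph Unit) t := fun t => by simp [IsLeaf]
  have hL : Set.BijOn (fun _ : A => ()) Set.univ {t | IsLeaf (⊥ : SimpleGraph Unit) t} :=
    ⟨fun _ _ => hleaf (), fun a _ b _ _ => Subsingleton.elim a b,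
      fun _ _ => ⟨Classical.arbitrary A, Set.mem_univ _, rfl⟩⟩
  exact ⟨hasTreeDecomposition_of_edgeSides hT hL fun t ht => absurd (hleaf t) ht,
    Unit, inferInstance, ⊥, fun _ => (), hT, fun t ht => absurd (hleaf t) ht, hL,
    fun s t h => absurd h (by simp)⟩

theorem Winnable.decompositions [Nonempty A] (hf : IsConnectivity f) (hk : ∀ a, 2 * f {a} ≤ k)
    (h : Winnable (part f k) (sing A) Finset.univ) :
    HasTreeDecomposition (part f k) (sing A) ∧ HasBranchDecomposition f k := by
  obtain ⟨r⟩ := ‹Nonempty A›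
  by_cases hA : ({r}ᶜ : Finset A).Nonempty
  · obtain ⟨lab, hlab⟩ := ((h.compl_singleton hf r).splittable hf hA).exists_isRooted
    exact ⟨hlab.hasTreeDecomposition, hlab.hasBranchDecomposition hf hk⟩
  · have hr : ∀ a, a = r := fun a => by
      by_contra ha
      exact hA ⟨a, by simpa using ha⟩
    have : Subsingleton A := ⟨fun a b => (hr a).trans (hr b).symm⟩
    have : Nonempty A := ⟨r⟩
    exact decompositions_of_subsingleton _ _ _

theorem IsConnectivity.two_mul_map_singleton_le [Nonempty A] (hf : IsConnectivity f)
    (h : IsScenario (part f k) (sing A)) (a : A) : 2 * f {a} ≤ k := by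
  have hp := h.pair_mem {a} (Or.inr ⟨a, rfl⟩)
  exact two_mul_le_of_saturated hf hp (hp.1.saturated_of_mem (Finset.mem_insert_self _ _))

theorem IsConnectivity.captainWins_tfae [Nonempty A] (hf : IsConnectivity f)
    (h : IsScenario (part f k) (sing A)) :
    List.TFAE [CaptainWins (part f k) (sing A), Winnable (part f k) (sing A) Finset.univ,
      CaptainWinsMonotone (part f k) (sing A), HasTreeDecomposition (part f k) (sing A)] := by
  have h0 : ∅ ∈ sing A := Or.inl rfl
  tfae_have 1 → 2 := fun hw => by
    by_contra hn
    obtain ⟨H, hH⟩ := exists_isHaven_of_not_winnable hf (fun _ hS _ hX => mem_sing_of_subset hS hX)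
      h0 hn
    exact hH.not_captainWins h.isPartition hw
  tfae_have 2 → 3 := fun hw => by
    refine hw.captainWinsMonotone h.isPartition ⟨isPartition_of_existsUnique fun a => ?_, ?_⟩
    · exact ⟨Finset.univ, Finset.mem_singleton_self _, Finset.mem_univ a,
        fun C hC _ => (Finset.mem_singleton.1 hC).symm⟩
    · rw [Finset.sum_singleton, hf.map_univ]
      exact Nat.zero_le _
  tfae_have 3 → 1 := CaptainWinsMonotone.captainWins
  tfae_have 2 → 4 := fun hw => (hw.decompositions hf (hf.two_mul_map_singleton_le h)).1
  tfae_have 4 → 2 := fun ht => ht.winnable h h0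
  tfae_finish

theorem exists_winnable (f : Finset A → ℕ) :
    ∃ k, (∀ a, 2 * f {a} ≤ k) ∧ Winnable (part f k) (sing A) Finset.univ := by
  let P : Finset (Finset A) := Finset.univ.image fun a => {a}
  -- The first sum pays for the partition into singletons, which wins in one move; the second bounds
  -- every `2 * f {a}`.
  refine ⟨∑ X ∈ P, f X + ∑ a, 2 * f {a}, fun a => ?_, ?_⟩
  · exact (Finset.single_le_sum (f := fun a => 2 * f {a}) (fun _ _ => Nat.zero_le _)
      (Finset.mem_univ a)).trans (Nat.le_add_left _ _)
  · refine .step P ⟨isPartition_of_existsUnique fun a => ?_, Nat.le_add_right _ _⟩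
      (saturated_univ _) fun B hB _ => ?_
    · refine ⟨{a}, Finset.mem_image_of_mem _ (Finset.mem_univ a), Finset.mem_singleton_self a, ?_⟩
      intro C hC haC
      obtain ⟨b, -, rfl⟩ := Finset.mem_image.1 hC
      rw [Finset.mem_singleton.1 haC]
    · obtain ⟨b, -, rfl⟩ := Finset.mem_image.1 hB
      exact .base (Or.inr ⟨b, rfl⟩)

theorem IsConnectivity.hasFactorThreeMonotoneGame [Nonempty A] (hf : IsConnectivity f) :
    HasFactorThreeMonotoneGame f (branchWidth f) where
  isScenario _ h := hf.isScenario h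
  isMonotone k h := (hf.captainWins_tfae h).out 0 2
  game_iff_tree k h := (hf.captainWins_tfae h).out 2 3
  factor_three := by
    have heq : gameBounds f = treeBounds f := by
      ext k
      exact and_congr_right fun h => (hf.captainWins_tfae h).out 2 3
    have hwin : ∀ k, (∀ a, 2 * f {a} ≤ k) → Winnable (part f k) (sing A) Finset.univ →
        k ∈ treeBounds f := fun k hk hw => ⟨hf.isScenario hk, (hw.decompositions hf hk).1⟩
    have hbranch : ∀ k ∈ treeBounds f, HasBranchDecomposition f k := by
      rintro k ⟨hs, ht⟩
      exact ((ht.winnable hs (Or.inl rfl)).decompositions hf (hf.two_mul_map_singleton_le hs)).2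
    have hne : (treeBounds f).Nonempty := by
      obtain ⟨k, hk, hw⟩ := exists_winnable f
      exact ⟨k, hwin k hk hw⟩
    have hleast : IsLeast (treeBounds f) (sInf (treeBounds f)) :=
      ⟨Nat.sInf_mem hne, fun k hk => Nat.sInf_le hk⟩
    -- The infimum is attained only because some decomposition exists; over the empty set it would
    -- be `0`.
    have hbw : HasBranchDecomposition f (branchWidth f) :=
      Nat.sInf_mem (s := {k | HasBranchDecomposition f k}) ⟨_, hbranch _ hleast.1⟩
    refine ⟨sInf (treeBounds f), heq ▸ hleast, hleast, Nat.sInf_le (hbranch _ hleast.1),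
      hleast.2 ⟨hf.isScenario fun a => ?_, hbw.hasTreeDecomposition⟩⟩
    have := hbw.map_singleton_le hf a
    omega

end Characterization

/-! ### The four cut functions are connectivity functions -/

section CutFunctions

variable {V : Type*} [Fintype V] [DecidableEq V] {K : Type*} [Field K]

/-- The rank of the submatrix of `M` with rows in `X` and columns in `Y`. -/
noncomputable def rankBetween (M : V → V → K) (X Y : Finset V) : ℕ :=
  (Matrix.of fun (x : {v // v ∈ X}) (y : {v // v ∈ Y}) => M x y).rank

omit [Fintype V] [DecidableEq V] in
theorem rankBetween_swap (M : V → V → K) (X Y : Finset V) :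
    rankBetween M Y X = rankBetween (fun x y => M y x) X Y := by
  rw [rankBetween, ← Matrix.rank_transpose]
  rfl

/-- The space spanned by the rows of `M` and the unit vectors with index in `X`. -/
def rowUnitSpan (M : V → V → K) (X : Finset V) : Submodule K (V → K) :=
  Submodule.span K (M '' X ∪ (fun x => Pi.single x 1) '' X)

omit [Fintype V] in
theorem rowUnitSpan_union (M : V → V → K) (X Y : Finset V) :
    rowUnitSpan M (X ∪ Y) = rowUnitSpan M X ⊔ rowUnitSpan M Y := by
  rw [rowUnitSpan, rowUnitSpan, rowUnitSpan, ← Submodule.span_union, Finset.coe_union,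
    Set.image_union, Set.image_union, Set.union_union_union_comm]

omit [Fintype V] in
theorem rowUnitSpan_mono (M : V → V → K) {X Y : Finset V} (h : X ⊆ Y) :
    rowUnitSpan M X ≤ rowUnitSpan M Y :=
  Submodule.span_mono (Set.union_subset_union (Set.image_mono h) (Set.image_mono h))

/-- Project onto the coordinates outside `X`. The kernel is spanned by the unit vectors with index
in `X`, and the image is the row space of the cut matrix. -/
theorem finrank_rowUnitSpan (M : V → V → K) (X : Finset V) :
    Module.finrank K (rowUnitSpan M X) = rankBetween M X Xᶜ + X.card := by
  let π : (V → K) →ₗ[K] ({v // v ∈ Xᶜ} → K) := LinearMap.funLeft K K Subtype.val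
  have hπ : Function.Surjective π := LinearMap.funLeft_surjective_of_injective _ _ _
    Subtype.val_injective
  have hker : LinearMap.ker π ≤ rowUnitSpan M X := by
    intro v hv
    rw [pi_eq_sum_univ' v]
    refine Submodule.sum_mem _ fun x _ => ?_
    by_cases hx : x ∈ X
    · refine Submodule.smul_mem _ _ (Submodule.subset_span (Or.inr ⟨x, hx, ?_⟩))
      ext y
      simp [Pi.single_apply, eq_comm]
    · have : v x = 0 := congrFun (LinearMap.mem_ker.1 hv) ⟨x, Finset.mem_compl.2 hx⟩
      rw [this, zero_smul]
      exact Submodule.zero_mem _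
  have hdimker : Module.finrank K (LinearMap.ker π) = X.card := by
    have h1 := π.finrank_range_add_finrank_ker
    rw [LinearMap.range_eq_top.2 hπ, finrank_top, Module.finrank_fintype_fun_eq_card,
      Module.finrank_fintype_fun_eq_card, Fintype.card_coe, Finset.card_compl] at h1
    have := X.card_le_univ
    omega
  have hmap : (rowUnitSpan M X).map π = Submodule.span K (Set.range
      (Matrix.of fun (x : {v // v ∈ X}) (y : {v // v ∈ Xᶜ}) => M x y).row) := by
    rw [rowUnitSpan, Submodule.map_span]
    apply le_antisymm
    · rw [Submodule.span_le]
      rintro _ ⟨_, ⟨x, hx, rfl⟩ | ⟨x, hx, rfl⟩, rfl⟩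
      · exact Submodule.subset_span ⟨⟨x, hx⟩, rfl⟩
      · have : π (Pi.single x 1) = 0 := by
          ext ⟨y, hy⟩
          have hyx : y ≠ x := fun h => Finset.mem_compl.1 hy (h ▸ hx)
          simp [π, LinearMap.funLeft_apply, hyx]
        simp only [this]
        exact Submodule.zero_mem _
    · rw [Submodule.span_le]
      rintro _ ⟨⟨x, hx⟩, rfl⟩
      exact Submodule.subset_span ⟨M x, Or.inl ⟨x, hx, rfl⟩, rfl⟩
  have h2 := (π.domRestrict (rowUnitSpan M X)).finrank_range_add_finrank_ker
  rw [LinearMap.range_domRestrict, hmap, ← Matrix.rank_eq_finrank_span_row,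
    LinearMap.ker_domRestrict] at h2
  rw [← h2, ← hdimker, rankBetween]
  congr 1
  exact (Submodule.comapSubtypeEquivOfLe hker).finrank_eq

/-- `rowUnitSpan` sends unions to sums and intersections into intersections, so its dimension is
submodular; the cardinalities in `finrank_rowUnitSpan` are modular and cancel. -/
theorem rankBetween_submodular (M : V → V → K) (X Y : Finset V) :
    rankBetween M (X ∪ Y) (X ∪ Y)ᶜ + rankBetween M (X ∩ Y) (X ∩ Y)ᶜ ≤
      rankBetween M X Xᶜ + rankBetween M Y Yᶜ := by
  have h := Submodule.finrank_sup_add_finrank_inf_eq (rowUnitSpan M X) (rowUnitSpan M Y)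
  have hle := Submodule.finrank_mono (le_inf (rowUnitSpan_mono M (Finset.inter_subset_left
    (s₁ := X) (s₂ := Y))) (rowUnitSpan_mono M (Finset.inter_subset_right (s₁ := X) (s₂ := Y))))
  rw [← rowUnitSpan_union] at h
  simp only [finrank_rowUnitSpan] at h hle
  have := Finset.card_union_add_card_inter X Y
  omega

theorem rankBetween_compl (M : V → V → K) (X : Finset V) :
    rankBetween M Xᶜ Xᶜᶜ = rankBetween (fun x y => M y x) X Xᶜ := by
  rw [compl_compl, rankBetween_swap]

omit [Fintype V] [DecidableEq V] in
theorem rankBetween_empty (M : V → V → K) (Y : Finset V) : rankBetween M ∅ Y = 0 := by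
  have := Matrix.rank_le_card_height
    (Matrix.of fun (x : {v // v ∈ (∅ : Finset V)}) (y : {v // v ∈ Y}) => M x y)
  simpa [rankBetween] using this

theorem isConnectivity_rankBetween (M : V → V → K)
    (hM : ∀ X Y, rankBetween (fun x y => M y x) X Y = rankBetween M X Y) :
    IsConnectivity fun X => rankBetween M X Xᶜ where
  map_empty := rankBetween_empty M _
  map_compl X := by rw [rankBetween_compl, hM]
  submodular := rankBetween_submodular M

theorem isConnectivity_rankBetween_add (M : V → V → K) :
    IsConnectivity fun X => rankBetween M X Xᶜ + rankBetween (fun x y => M y x) X Xᶜ where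
  map_empty := by rw [rankBetween_empty, rankBetween_empty]
  map_compl X := by rw [rankBetween_compl, rankBetween_compl, add_comm]
  submodular X Y := by
    have h1 := rankBetween_submodular M X Y
    have h2 := rankBetween_submodular (fun x y => M y x) X Y
    omega

theorem isConnectivity_cutRank (G : SimpleGraph V) : IsConnectivity (cutRank G) := by
  classical
  refine isConnectivity_rankBetween (fun x y => if G.Adj x y then (1 : ZMod 2) else 0) ?_
  intro X Y
  simp only [G.adj_comm]

theorem isConnectivity_biCutRank (D : Digraph V) : IsConnectivity (biCutRank D) := by
  classical
  exact isConnectivity_rankBetween_add fun x y => if D.Adj x y then (1 : ZMod 2) else 0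

omit [Fintype V] [DecidableEq V] in
-- An automorphism of the field maps one row space semilinearly and bijectively onto the other.
theorem rankBetween_map (σ : K ≃+* K) (M : V → V → K) (X Y : Finset V) :
    rankBetween (fun x y => σ (M x y)) X Y = rankBetween M X Y := by
  have : RingHomInvPair (σ : K →+* K) (σ.symm : K →+* K) := RingHomInvPair.of_ringEquiv σ
  have : RingHomInvPair (σ.symm : K →+* K) (σ : K →+* K) := RingHomInvPair.symm _ _
  let φ : ({v // v ∈ Y} → K) →ₛₗ[(σ : K →+* K)] ({v // v ∈ Y} → K) :=
    { toFun := fun v y => σ (v y)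
      map_add' := fun v w => by ext y; simp
      map_smul' := fun c v => by ext y; simp }
  have hφ : Function.Injective φ := fun v w h => by
    ext y
    exact σ.injective (congrFun h y)
  let A : Matrix {v // v ∈ X} {v // v ∈ Y} K := Matrix.of fun x y => M x y
  let B : Matrix {v // v ∈ X} {v // v ∈ Y} K := Matrix.of fun x y => σ (M x y)
  have hspan : (Submodule.span K (Set.range A.row)).map φ = Submodule.span K (Set.range B.row) := by
    rw [Submodule.map_span, ← Set.range_comp]
    rfl
  change B.rank = A.rank
  rw [Matrix.rank_eq_finrank_span_row, Matrix.rank_eq_finrank_span_row, ← hspan]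
  have e := Submodule.equivMapOfInjective φ hφ (Submodule.span K (Set.range A.row))
  exact (congrArg Cardinal.toNat (rank_eq_of_equiv_equiv σ e.toAddEquiv σ.bijective
    fun c v => e.map_smulₛₗ c v)).symm

theorem gf4Generator_pow_four : gf4Generator ^ 4 = gf4Generator := by
  have : Fintype (GaloisField 2 2) := Fintype.ofFinite _
  have h := FiniteField.pow_card gf4Generator
  rwa [← Nat.card_eq_fintype_card, GaloisField.card 2 2 two_ne_zero] at h

omit [Fintype V] [DecidableEq V] in
-- Squaring fixes `0` and `1` and exchanges `a` and `a²`, since `a⁴ = a`. Hence transposing the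
-- matrix amounts to a field automorphism and preserves ranks.
theorem gf4Entry_swap (D : Digraph V) (x y : V) :
    gf4Entry D y x = frobeniusEquiv (GaloisField 2 2) 2 (gf4Entry D x y) := by
  rw [frobeniusEquiv_apply, frobenius_def, gf4Entry, gf4Entry]
  split_ifs
  · rw [one_pow]
  · rw [← pow_mul, gf4Generator_pow_four]
  · rfl
  · rw [zero_pow two_ne_zero]

theorem isConnectivity_gf4CutRank (D : Digraph V) : IsConnectivity (gf4CutRank D) := by
  refine isConnectivity_rankBetween (gf4Entry D) fun X Y => ?_
  rw [← rankBetween_map (frobeniusEquiv (GaloisField 2 2) 2) (gf4Entry D)]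
  congr 1
  funext x y
  exact gf4Entry_swap D x y

theorem isConnectivity_cutSize (G : SimpleGraph V) : IsConnectivity (cutSize G) := by
  classical
  -- As a sum of indicators over ordered pairs, the cut size can be checked for submodularity one
  -- pair at a time; complementing `X` just swaps each pair.
  have hcut : ∀ X, cutSize G X = ∑ e : V × V,
      if e.1 ∈ X ∧ e.2 ∉ X ∧ G.Adj e.1 e.2 then 1 else 0 := by
    intro X
    rw [Finset.sum_boole, Nat.cast_id, cutSize]
    congr 1
    ext e
    simp [SimpleGraph.interedges, Rel.mem_interedges_iff]
  refine ⟨?_, fun X => ?_, fun X Y => ?_⟩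
  · simp [hcut]
  · rw [hcut, hcut]
    refine Fintype.sum_equiv (Equiv.prodComm V V) _ _ fun e => ?_
    simp only [Finset.mem_compl, not_not, Equiv.prodComm_apply, Prod.fst_swap, Prod.snd_swap,
      G.adj_comm e.2]
    exact if_congr (by tauto) rfl rfl
  · simp only [hcut, ← Finset.sum_add_distrib]
    refine Finset.sum_le_sum fun e _ => ?_
    by_cases h1 : e.1 ∈ X <;> by_cases h2 : e.1 ∈ Y <;> by_cases h3 : e.2 ∈ X <;>
      by_cases h4 : e.2 ∈ Y <;> by_cases h5 : G.Adj e.1 e.2 <;> simp [h1, h2, h3, h4, h5]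

end CutFunctions

end CaptainRobber

theorem mainTheorem9 {V : Type*} [Fintype V] [DecidableEq V] [Nonempty V]
    (G : SimpleGraph V) (D : Digraph V) :
    CaptainRobber.HasFactorThreeMonotoneGame
      (CaptainRobber.cutRank G) (CaptainRobber.rankWidth G) ∧
    CaptainRobber.HasFactorThreeMonotoneGame
      (CaptainRobber.cutSize G) (CaptainRobber.carvingWidth G) ∧
    CaptainRobber.HasFactorThreeMonotoneGame
      (CaptainRobber.gf4CutRank D) (CaptainRobber.gf4RankWidth D) ∧
    CaptainRobber.HasFactorThreeMonotoneGame
      (CaptainRobber.biCutRank D) (CaptainRobber.biRankWidth D) :=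
  ⟨(CaptainRobber.isConnectivity_cutRank G).hasFactorThreeMonotoneGame,
    (CaptainRobber.isConnectivity_cutSize G).hasFactorThreeMonotoneGame,
    (CaptainRobber.isConnectivity_gf4CutRank D).hasFactorThreeMonotoneGame,
    (CaptainRobber.isConnectivity_biCutRank D).hasFactorThreeMonotoneGame⟩
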